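/- All vector spaces are over $\mathbb{C}$. A Lie conformal algebra is a $\mathbb{C}[\partial]$-module $R$ with a linear $\lambda$-bracket $R\otimes R\to R[\lambda]$ that is conformally sesquilinear ($[\partial a\,{}_\lambda b]=-\lambda[a\,{}_\lambda b]$, $[a\,{}_\lambda\partial b]=(\partial+\lambda)[a\,{}_\lambda b]$), skew-symmetric ($[a\,{}_\lambda b]=-[b\,{}_{-\lambda-\partial}a]$) and satisfies the Jacobi identity $[a\,{}_\lambda[b\,{}_\mu c]]=[[a\,{}_\lambda b]\,{}_{\lambda+\mu}c]+[b\,{}_\mu[a\,{}_\lambda c]]$. A conformal module over $R$ is a $\mathbb{C}[\partial]$-module $V$ with a linear $\lambda$-action $R\otimes V\to V[\lambda]$ such that $$(\partial a)\,{}_\lambda v=-\lambda\, a\,{}_\lambda v,\quad a\,{}_\lambda(\partial v)=(\partial+\lambda)\,a\,{}_\lambda v,\quad a\,{}_\lambda(b\,{}_\mu v)-b\,{}_\mu(a\,{}_\lambda v)=[a\,{}_\lambda b]\,{}_{\lambda+\mu}v;$$ it is nontrivial if its $\lambda$-action is not identically zero. An isomorphism is a $\mathbb{C}[\partial]$-linear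 bijection commuting with the $\lambda$-actions. The loop Schrödinger–Virasoro Lie conformal algebra $\mathfrak{csv}$ is the free $\mathbb{C}[\partial]$-module with basis $\{L_i,M_i,Y_i\mid i\in\mathbb{Z}\}$ and nonvanishing $\lambda$-brackets of basis elements $$[L_i\,{}_\lambda L_j]=(\partial+2\lambda)L_{i+j},\quad [L_i\,{}_\lambda M_j]=(\partial+\lambda)M_{i+j},\quad [M_i\,{}_\lambda L_j]=\lambda M_{i+j},$$ $$[L_i\,{}_\lambda Y_j]=(\partial+\tfrac32\lambda)Y_{i+j},\quad [Y_i\,{}_\lambda L_j]=(\tfrac12\partial+\tfrac32\lambda)Y_{i+j},\quad [Y_i\,{}_\lambda Y_j]=(\partial+2\lambda)M_{i+j}.$$ The extended algebra $\widetilde{\mathfrak{csv}}$ is the free $\mathbb{C}[\partial]$-module with basis $\{L_i,M_i,Y_i,N_i\mid i\in\mathbb{Z}\}$, with the above brackets and the further nonvanishing brackets $$[L_i\,{}_\lambda N_j]=(\partial+\lambda)N_{i+j},\quad [N_i\,{}_\lambda L_j]=\lambda N_{i+j},\quad [N_i\,{}_\lambda M_j]=2M_{i+j},$$ $$[M_i\,{}_\lambda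 N_j]=-2M_{i+j},\quad [N_i\,{}_\lambda Y_j]=Y_{i+j},\quad [Y_i\,{}_\lambda N_j]=-Y_{i+j}.$$ Both are $\mathbb{Z}$-graded, the component $R_i$ being the $\mathbb{C}[\partial]$-span of the basis elements with index $i$. A $\mathbb{Z}$-graded free intermediate series module over such an algebra $R$ is a conformal module $V=\bigoplus_{i\in\mathbb{Z}}V_i$, where the $V_i$ are $\mathbb{C}[\partial]$-submodules with $R_i\,{}_\lambda V_j\subset V_{i+j}[\lambda]$ for all $i,j$, and each $V_i$ is freely generated over $\mathbb{C}[\partial]$ by one element. On the free $\mathbb{C}[\partial]$-module $\bigoplus_{m\in\mathbb{Z}}\mathbb{C}[\partial]v_m$ consider the following $\lambda$-actions, in all of which $M_i\,{}_\lambda v_m=Y_i\,{}_\lambda v_m=0$ for all $i,m\in\mathbb Z$. For $a,b\in\mathbb{C}$, $V_{a,b,0,0}$ has $$L_i\,{}_\lambda v_m=(\partial+a\lambda+b)v_{i+m}.$$ For a sequence $A=(a_i)_{i\in\mathbb{Z}}\in\{0,1\}^{\mathbb{Z}}$ and $b\in\mathbb{C}$, $V_{A,b,0,0}$ has $$L_i\,{}_\lambda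 v_m=\begin{cases}(\partial+b)v_{i+m}&\text{if }(a_m,a_{i+m})=(0,0),\\(\partial+b+\lambda)v_{i+m}&\text{if }(a_m,a_{i+m})=(1,1),\\ v_{i+m}&\text{if }(a_m,a_{i+m})=(0,1),\\(\partial+b)(\partial+b+\lambda)v_{i+m}&\text{if }(a_m,a_{i+m})=(1,0).\end{cases}$$ For $d\in\mathbb{C}$, $V_{a,b,0,0,d}$ and $V_{A,b,0,0,d}$ denote the same spaces with the same $\lambda$-actions of $L_i,M_i,Y_i$ and in addition $N_i\,{}_\lambda v_m=d\,v_{i+m}$ for all $i,m\in\mathbb{Z}$. (For nonconstant $A$ these formulas define a module over $\widetilde{\mathfrak{csv}}$ only when $d=0$.) **Theorem.** (1) Every nontrivial $\mathbb{Z}$-graded free intermediate series module over $\mathfrak{csv}$ is isomorphic to $V_{a,b,0,0}$ for some $a,b\in\mathbb{C}$, or to $V_{A,b,0,0}$ for some $A\in\{0,1\}^{\mathbb{Z}}$ and $b\in\mathbb{C}$. (2) Every nontrivial $\mathbb{Z}$-graded free intermediate series module over $\widetilde{\mathfrak{csv}}$ is isomorphic to $V_{a,b,0,0,d}$ for some $a,b,d\in\mathbb{C}$,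 or to $V_{A,b,0,0,d}$ for some $A\in\{0,1\}^{\mathbb{Z}}$ and $b,d\in\mathbb{C}$. -/

import Mathlib

open Polynomial

noncomputable section

/-! Throughout, a `ℂ[∂]`-module is a module over `ℂ[X]` (with `X` acting as `∂`), and
`V[λ] = ℂ[λ] ⊗ V` is `PolynomialModule ℂ V`: an element is a finite sum `∑ₙ λⁿ vₙ`, with
`vₙ = p.coeff n`. -/

/-- Linear maps `R ⊗ V → V[λ]`, `a ⊗ v ↦ a_λ v`. -/
abbrev LambdaMap (R V : Type*) [AddCommGroup R] [Module ℂ R] [AddCommGroup V] [Module ℂ V] :=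
  R →ₗ[ℂ] V →ₗ[ℂ] PolynomialModule ℂ V

/-- The value of `a_λ v` at a complex number `λ = t`, that is `∑ₙ tⁿ vₙ`. As `ℂ` is infinite, an
identity between polynomials in `λ` (and `μ`) with coefficients in `V` is the same as the identity
of their values at all complex numbers. -/
def LambdaMap.ev {R V : Type*} [AddCommGroup R] [Module ℂ R] [AddCommGroup V] [Module ℂ V]
    (ρ : LambdaMap R V) (t : ℂ) : R →ₗ[ℂ] V →ₗ[ℂ] V :=
  ρ.compr₂ (PolynomialModule.eval t)

/-- Substitution of a polynomial `u = u(∂)` for `λ` in an element of `V[λ]`: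
`∑ₙ λⁿ vₙ ↦ ∑ₙ u(∂)ⁿ vₙ`. -/
def lamSubst {V : Type*} [AddCommGroup V] [Module ℂ V] [Module ℂ[X] V]
    (u : ℂ[X]) (p : PolynomialModule ℂ V) : V :=
  p.coeff.sum fun n v => u ^ n • v

/-- Lie conformal algebras. -/
class LieConformalAlgebra (R : Type*) [AddCommGroup R] [Module ℂ R] [Module ℂ[X] R]
    [IsScalarTower ℂ ℂ[X] R] where
  /-- The `λ`-bracket `[a_λ b]`. -/
  bracket : LambdaMap R R
  /-- `[∂a_λ b] = -λ [a_λ b]` -/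
  bracket_del_left : ∀ (a b : R) (l : ℂ),
    bracket.ev l ((X : ℂ[X]) • a) b = -(l • bracket.ev l a b)
  /-- `[a_λ ∂b] = (∂ + λ) [a_λ b]` -/
  bracket_del_right : ∀ (a b : R) (l : ℂ),
    bracket.ev l a ((X : ℂ[X]) • b) = (X : ℂ[X]) • bracket.ev l a b + l • bracket.ev l a b
  /-- `[a_λ b] = -[b_{-λ-∂} a]` -/
  skew : ∀ (a b : R) (l : ℂ),
    bracket.ev l a b = -lamSubst (-C l - X) (bracket b a)
  /-- `[a_λ [b_μ c]] = [[a_λ b]_{λ+μ} c] + [b_μ [a_λ c]]` -/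
  jacobi : ∀ (a b c : R) (l m : ℂ),
    bracket.ev l a (bracket.ev m b c) =
      bracket.ev (l + m) (bracket.ev l a b) c + bracket.ev m b (bracket.ev l a c)

section Modules

variable {R : Type*} [AddCommGroup R] [Module ℂ R] [Module ℂ[X] R] [IsScalarTower ℂ ℂ[X] R]
variable {V : Type*} [AddCommGroup V] [Module ℂ V] [Module ℂ[X] V]
variable {W : Type*} [AddCommGroup W] [Module ℂ W] [Module ℂ[X] W]

/-- `ℤ`-gradings of a Lie conformal algebra. -/
structure IsZGrading [LieConformalAlgebra R] (G : ℤ → Submodule ℂ[X] R) : Prop where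
  isInternal : DirectSum.IsInternal G
  bracket_mem : ∀ (i j : ℤ), ∀ a ∈ G i, ∀ b ∈ G j, ∀ n : ℕ,
    (LieConformalAlgebra.bracket a b).coeff n ∈ G (i + j)

/-- The `λ`-action `ρ` makes the `ℂ[∂]`-module `V` a conformal module over `R`. -/
structure IsConformalModule [LieConformalAlgebra R] (ρ : LambdaMap R V) : Prop where
  /-- `(∂a)_λ v = -λ a_λ v` -/
  del_left : ∀ (a : R) (v : V) (l : ℂ),
    ρ.ev l ((X : ℂ[X]) • a) v = -(l • ρ.ev l a v)
  /-- `a_λ (∂v) = (∂ + λ) a_λ v` -/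
  del_right : ∀ (a : R) (v : V) (l : ℂ),
    ρ.ev l a ((X : ℂ[X]) • v) = (X : ℂ[X]) • ρ.ev l a v + l • ρ.ev l a v
  /-- `a_λ (b_μ v) - b_μ (a_λ v) = [a_λ b]_{λ+μ} v` -/
  commutator : ∀ (a b : R) (v : V) (l m : ℂ),
    ρ.ev l a (ρ.ev m b v) - ρ.ev m b (ρ.ev l a v) =
      ρ.ev (l + m) ((LieConformalAlgebra.bracket (R := R)).ev l a b) v

/-- The `λ`-action is not identically zero. -/
def IsNontrivialAction (ρ : LambdaMap R V) : Prop := ∃ a v, ρ a v ≠ 0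

/-- `V` is a `ℤ`-graded free intermediate series module over the Lie conformal algebra `R` with
`ℤ`-grading `G`: it is a conformal module, and `V = ⨁ Vᵢ` for `ℂ[∂]`-submodules `Vᵢ` with
`(Rᵢ)_λ Vⱼ ⊆ Vᵢ₊ⱼ[λ]`, each `Vᵢ` being freely generated over `ℂ[∂]` by one element. -/
def IsFreeIntermediateSeries [LieConformalAlgebra R] (G : ℤ → Submodule ℂ[X] R)
    (ρ : LambdaMap R V) : Prop :=
  IsConformalModule ρ ∧
  ∃ U : ℤ → Submodule ℂ[X] V,
    DirectSum.IsInternal U ∧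
    (∀ (i j : ℤ), ∀ a ∈ G i, ∀ v ∈ U j, ∀ n : ℕ, (ρ a v).coeff n ∈ U (i + j)) ∧
    ∀ i : ℤ, ∃ v : V, U i = Submodule.span ℂ[X] {v} ∧ ∀ p : ℂ[X], p • v = 0 → p = 0

/-- Isomorphism of `ℂ[∂]`-modules with `λ`-actions of `R`: a `ℂ[∂]`-linear bijection `φ` with
`φ (a_λ v) = a_λ (φ v)`. -/
def AreIsomorphic (ρ : LambdaMap R V) (σ : LambdaMap R W) : Prop :=
  ∃ φ : V ≃ₗ[ℂ[X]] W, ∀ (a : R) (v : V) (n : ℕ), φ ((ρ a v).coeff n) = (σ a (φ v)).coeff n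

end Modules

/-! ### Sesquilinear extension of a `λ`-operation given on free generators -/

/-- `∂` in `ℂ[∂][λ]`. -/
abbrev del : ℂ[X][X] := C X

/-- `λ` in `ℂ[∂][λ]`. -/
abbrev lam : ℂ[X][X] := X

/-- The complex number `z` in `ℂ[∂][λ]`. -/
abbrev cst (z : ℂ) : ℂ[X][X] := C (C z)

section Sesq

variable {ι κ : Type*}

/-- The identification of the free `ℂ[∂][λ]`-module on `κ` with `V[λ]`, where `V` is the free
`ℂ[∂]`-module on `κ`. -/
def toLam (κ : Type*) : (κ →₀ ℂ[X][X]) →ₗ[ℂ] PolynomialModule ℂ (κ →₀ ℂ[X]) :=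
  Finsupp.lsum ℂ fun k =>
    (PolynomialModule.map ℂ (Finsupp.lsingle (R := ℂ) k)).comp
      (PolynomialModule.equivPolynomial (R := ℂ) (S := ℂ[X])).symm.toLinearMap

/-- `(p, q) ↦ p(-λ) q(∂ + λ)`. -/
def sesqFactor : ℂ[X] →ₗ[ℂ] ℂ[X] →ₗ[ℂ] ℂ[X][X] :=
  (LinearMap.mul ℂ ℂ[X][X]).compl₁₂ (aeval (-lam)).toLinearMap (aeval (del + lam)).toLinearMap

/-- For free `ℂ[∂]`-modules with bases `(eᵢ)` and `(fₖ)`, the `λ`-operation with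
`p(∂)eᵢ _λ q(∂)fₖ = p(-λ) q(∂ + λ) c i k`. -/
def sesq (c : ι → κ → κ →₀ ℂ[X][X]) : LambdaMap (ι →₀ ℂ[X]) (κ →₀ ℂ[X]) :=
  Finsupp.lsum ℂ fun i => LinearMap.flip <| Finsupp.lsum ℂ fun k => LinearMap.flip <|
    sesqFactor.compr₂ <|
      (toLam κ).comp ((LinearMap.toSpanSingleton ℂ[X][X] _ (c i k)).restrictScalars ℂ)

end Sesq

section SesqLemmas

variable {ι κ : Type*}

theorem sesq_single (c : ι → κ → κ →₀ ℂ[X][X]) (i : ι) (k : κ) (p q : ℂ[X]) :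
    sesq c (Finsupp.single i p) (Finsupp.single k q) =
      toLam κ ((aeval (-lam) p * aeval (del + lam) q) • c i k) := by
  simp [sesq, sesqFactor]

theorem lamSubst_add {V : Type*} [AddCommGroup V] [Module ℂ V] [Module ℂ[X] V]
    (u : ℂ[X]) (p q : PolynomialModule ℂ V) :
    lamSubst u (p + q) = lamSubst u p + lamSubst u q := by
  unfold lamSubst
  exact Finsupp.sum_add_index' (fun _ => smul_zero _) fun _ _ _ => smul_add _ _ _

theorem eval_eq_lamSubst {V : Type*} [AddCommGroup V] [Module ℂ V] [Module ℂ[X] V]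
    [IsScalarTower ℂ ℂ[X] V] (t : ℂ) (p : PolynomialModule ℂ V) :
    PolynomialModule.eval t p = lamSubst (C t) p := by
  rw [PolynomialModule.eval_apply]
  unfold lamSubst
  congr 1
  funext n v
  rw [← C_pow, ← Polynomial.algebraMap_eq, algebraMap_smul]

theorem lamSubst_toLam (u : ℂ[X]) (P : κ →₀ ℂ[X][X]) :
    lamSubst u (toLam κ P) = Finsupp.mapRange (Polynomial.eval u) eval_zero P := by
  induction P using Finsupp.induction_linear with
  | zero => simp [lamSubst]
  | add P Q hP hQ =>
    rw [map_add, lamSubst_add, hP, hQ, Finsupp.mapRange_add (fun _ _ => eval_add)]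
  | single k P =>
    induction P using Polynomial.induction_on' with
    | add P Q hP hQ =>
      rw [Finsupp.single_add, map_add, lamSubst_add, hP, hQ,
        Finsupp.mapRange_add (fun _ _ => eval_add)]
    | monomial n a =>
      simp only [toLam, Finsupp.lsum_single, LinearMap.comp_apply, LinearEquiv.coe_coe,
        PolynomialModule.equivPolynomial_symm_monomial, PolynomialModule.map_single,
        Finsupp.mapRange_single, eval_monomial]
      simp [lamSubst, PolynomialModule.coeff_single, mul_comm]

theorem sesq_ev_single (c : ι → κ → κ →₀ ℂ[X][X]) (i : ι) (k : κ) (p q : ℂ[X]) (t : ℂ) :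
    (sesq c).ev t (Finsupp.single i p) (Finsupp.single k q) =
      (C (p.eval (-t)) * q.comp (X + C t)) •
        Finsupp.mapRange (Polynomial.eval (C t)) eval_zero (c i k) := by
  rw [LambdaMap.ev, LinearMap.compr₂_apply, eval_eq_lamSubst, sesq_single, lamSubst_toLam]
  ext1 k'
  simp only [Finsupp.mapRange_apply, Finsupp.smul_apply, smul_eq_mul, eval_mul]
  congr 2
  · induction p using Polynomial.induction_on' with
    | add p q hp hq => simp [hp, hq]
    | monomial n a => simp [aeval_monomial]
  · induction q using Polynomial.induction_on' with
    | add p q hp hq => simp [hp, hq]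
    | monomial n a => simp [aeval_monomial]

theorem sesq_skew_single (c : ι → κ → κ →₀ ℂ[X][X]) (i : ι) (k : κ) (p q : ℂ[X]) (t : ℂ) :
    lamSubst (-C t - X) (sesq c (Finsupp.single i p) (Finsupp.single k q)) =
      (p.comp (X + C t) * C (q.eval (-t))) •
        Finsupp.mapRange (Polynomial.eval (-C t - X)) eval_zero (c i k) := by
  rw [sesq_single, lamSubst_toLam]
  ext1 k'
  simp only [Finsupp.mapRange_apply, Finsupp.smul_apply, smul_eq_mul, eval_mul]
  congr 2
  · induction p using Polynomial.induction_on' with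
    | add p q hp hq => simp [hp, hq]
    | monomial n a => simp [aeval_monomial]
  · induction q using Polynomial.induction_on' with
    | add p q hp hq => simp [hp, hq]
    | monomial n a => simp [aeval_monomial]

theorem sesq_ev_smul_left (c : ι → κ → κ →₀ ℂ[X][X]) (p : ℂ[X]) (a : ι →₀ ℂ[X])
    (v : κ →₀ ℂ[X]) (t : ℂ) :
    (sesq c).ev t (p • a) v = p.eval (-t) • (sesq c).ev t a v := by
  induction a using Finsupp.induction_linear with
  | zero => simp
  | add a b ha hb => simp only [smul_add, map_add, LinearMap.add_apply, ha, hb]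
  | single i r =>
    induction v using Finsupp.induction_linear with
    | zero => simp
    | add v w hv hw => simp only [smul_add, map_add, hv, hw]
    | single k q =>
      rw [Finsupp.smul_single, smul_eq_mul, sesq_ev_single, sesq_ev_single]
      rw [← algebraMap_smul ℂ[X] (p.eval (-t)), smul_smul]
      congr 1
      simp [Polynomial.algebraMap_eq]
      ring

theorem sesq_ev_smul_right (c : ι → κ → κ →₀ ℂ[X][X]) (q : ℂ[X]) (a : ι →₀ ℂ[X])
    (v : κ →₀ ℂ[X]) (t : ℂ) :
    (sesq c).ev t a (q • v) = q.comp (X + C t) • (sesq c).ev t a v := by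
  induction a using Finsupp.induction_linear with
  | zero => simp
  | add a b ha hb => simp only [smul_add, map_add, LinearMap.add_apply, ha, hb]
  | single i r =>
    induction v using Finsupp.induction_linear with
    | zero => simp
    | add v w hv hw => simp only [smul_add, map_add, hv, hw]
    | single k q =>
      rw [Finsupp.smul_single, smul_eq_mul, sesq_ev_single, sesq_ev_single, smul_smul]
      congr 1
      simp
      ring

theorem sesq_del_left (c : ι → κ → κ →₀ ℂ[X][X]) (a : ι →₀ ℂ[X]) (v : κ →₀ ℂ[X]) (t : ℂ) :
    (sesq c).ev t ((X : ℂ[X]) • a) v = -(t • (sesq c).ev t a v) := by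
  rw [sesq_ev_smul_left, eval_X, neg_smul]

theorem sesq_del_right (c : ι → κ → κ →₀ ℂ[X][X]) (a : ι →₀ ℂ[X]) (v : κ →₀ ℂ[X]) (t : ℂ) :
    (sesq c).ev t a ((X : ℂ[X]) • v) =
      (X : ℂ[X]) • (sesq c).ev t a v + t • (sesq c).ev t a v := by
  rw [sesq_ev_smul_right, X_comp, add_smul, ← Polynomial.algebraMap_eq, algebraMap_smul]

/-- The commutator identity on generators implies it everywhere. -/
theorem sesq_commutator (d : ι → ι → ι →₀ ℂ[X][X]) (c : ι → κ → κ →₀ ℂ[X][X])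
    (h : ∀ (i j : ι) (k : κ) (l m : ℂ),
      (sesq c).ev l (Finsupp.single i 1) ((sesq c).ev m (Finsupp.single j 1) (Finsupp.single k 1)) -
      (sesq c).ev m (Finsupp.single j 1) ((sesq c).ev l (Finsupp.single i 1) (Finsupp.single k 1)) =
      (sesq c).ev (l + m) ((sesq d).ev l (Finsupp.single i 1) (Finsupp.single j 1))
        (Finsupp.single k 1))
    (a b : ι →₀ ℂ[X]) (v : κ →₀ ℂ[X]) (l m : ℂ) :
    (sesq c).ev l a ((sesq c).ev m b v) - (sesq c).ev m b ((sesq c).ev l a v) =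
      (sesq c).ev (l + m) ((sesq d).ev l a b) v := by
  induction a using Finsupp.induction_linear with
  | zero => simp
  | add a b ha hb =>
    simp only [map_add, LinearMap.add_apply]
    rw [← ha, ← hb]; abel
  | single i p =>
  induction b using Finsupp.induction_linear with
  | zero => simp
  | add a b ha hb =>
    simp only [map_add, LinearMap.add_apply]
    rw [← ha, ← hb]; abel
  | single j q =>
  induction v using Finsupp.induction_linear with
  | zero => simp
  | add a b ha hb =>
    simp only [map_add]
    rw [← ha, ← hb]; abel
  | single k r =>
  rw [← Finsupp.smul_single_one i p, ← Finsupp.smul_single_one j q, ← Finsupp.smul_single_one k r]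
  simp only [sesq_ev_smul_left, sesq_ev_smul_right, map_smul, LinearMap.smul_apply]
  rw [← h i j k l m]
  simp only [smul_sub, smul_smul, ← algebraMap_smul ℂ[X] (_ : ℂ), Polynomial.algebraMap_eq]
  congr 2
  · simp only [comp_assoc, add_comp, X_comp, C_comp, eval_comp, eval_add, eval_X, eval_C, C_add]
    ring_nf
  · simp only [comp_assoc, add_comp, X_comp, C_comp, eval_comp, eval_add, eval_X, eval_C, C_add]
    ring_nf

theorem sesq_skew (c : ι → ι → ι →₀ ℂ[X][X])
    (h : ∀ (i j : ι) (t : ℂ), Finsupp.mapRange (Polynomial.eval (C t)) eval_zero (c i j) =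
      -Finsupp.mapRange (Polynomial.eval (-C t - X)) eval_zero (c j i))
    (a b : ι →₀ ℂ[X]) (t : ℂ) :
    (sesq c).ev t a b = -lamSubst (-C t - X) (sesq c b a) := by
  induction a using Finsupp.induction_linear with
  | zero => simp [lamSubst]
  | add a b ha hb =>
    simp only [map_add, LinearMap.add_apply, lamSubst_add, ha, hb, neg_add]
  | single i p =>
  induction b using Finsupp.induction_linear with
  | zero => simp [lamSubst]
  | add a b ha hb =>
    simp only [map_add, LinearMap.add_apply, lamSubst_add, ha, hb, neg_add]
  | single j q =>
  rw [sesq_ev_single, sesq_skew_single, h i j t, smul_neg]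
  congr 2
  ring

end SesqLemmas

/-! ### The two Lie conformal algebras -/

/-- Types of generators of the loop Schrödinger-Virasoro Lie conformal algebra. -/
inductive SVGen where
  | L | M | Y

/-- Types of generators of the extended loop Schrödinger-Virasoro Lie conformal algebra. -/
inductive ExtSVGen where
  | L | M | Y | N

/-- The free `ℂ[∂]`-module with basis `Lᵢ, Mᵢ, Yᵢ`, `i ∈ ℤ`. -/
abbrev Csv := SVGen × ℤ →₀ ℂ[X]

/-- The free `ℂ[∂]`-module with basis `Lᵢ, Mᵢ, Yᵢ, Nᵢ`, `i ∈ ℤ`. -/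
abbrev ExtCsv := ExtSVGen × ℤ →₀ ℂ[X]

/-- The `λ`-brackets of the generators of `Csv`. -/
def csvBracket : SVGen × ℤ → SVGen × ℤ → SVGen × ℤ →₀ ℂ[X][X]
  | (.L, i), (.L, j) => Finsupp.single (.L, i + j) (del + 2 * lam)
  | (.L, i), (.M, j) => Finsupp.single (.M, i + j) (del + lam)
  | (.M, i), (.L, j) => Finsupp.single (.M, i + j) lam
  | (.L, i), (.Y, j) => Finsupp.single (.Y, i + j) (del + cst (3 / 2) * lam)
  | (.Y, i), (.L, j) => Finsupp.single (.Y, i + j) (cst (1 / 2) * del + cst (3 / 2) * lam)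
  | (.Y, i), (.Y, j) => Finsupp.single (.M, i + j) (del + 2 * lam)
  | (.M, _), (.M, _) => 0
  | (.M, _), (.Y, _) => 0
  | (.Y, _), (.M, _) => 0

/-- The `λ`-brackets of the generators of `ExtCsv`. -/
def extCsvBracket : ExtSVGen × ℤ → ExtSVGen × ℤ → ExtSVGen × ℤ →₀ ℂ[X][X]
  | (.L, i), (.L, j) => Finsupp.single (.L, i + j) (del + 2 * lam)
  | (.L, i), (.M, j) => Finsupp.single (.M, i + j) (del + lam)
  | (.M, i), (.L, j) => Finsupp.single (.M, i + j) lam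
  | (.L, i), (.Y, j) => Finsupp.single (.Y, i + j) (del + cst (3 / 2) * lam)
  | (.Y, i), (.L, j) => Finsupp.single (.Y, i + j) (cst (1 / 2) * del + cst (3 / 2) * lam)
  | (.Y, i), (.Y, j) => Finsupp.single (.M, i + j) (del + 2 * lam)
  | (.L, i), (.N, j) => Finsupp.single (.N, i + j) (del + lam)
  | (.N, i), (.L, j) => Finsupp.single (.N, i + j) lam
  | (.N, i), (.M, j) => Finsupp.single (.M, i + j) 2
  | (.M, i), (.N, j) => Finsupp.single (.M, i + j) (-2)
  | (.N, i), (.Y, j) => Finsupp.single (.Y, i + j) 1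
  | (.Y, i), (.N, j) => Finsupp.single (.Y, i + j) (-1)
  | (.M, _), (.M, _) => 0
  | (.M, _), (.Y, _) => 0
  | (.Y, _), (.M, _) => 0
  | (.N, _), (.N, _) => 0


theorem csvBracket_skew (x y : SVGen × ℤ) (t : ℂ) :
    Finsupp.mapRange (Polynomial.eval (C t)) eval_zero (csvBracket x y) =
      -Finsupp.mapRange (Polynomial.eval (-C t - X)) eval_zero (csvBracket y x) := by
  obtain ⟨x, i⟩ := x
  obtain ⟨y, j⟩ := y
  cases x <;> cases y <;>
    simp only [csvBracket, Finsupp.mapRange_single, Finsupp.mapRange_zero, neg_zero,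
      ← Finsupp.single_neg, add_comm j i] <;>
    (refine congrArg (Finsupp.single _) (Polynomial.funext fun x => ?_)
     simp
     try ring)

theorem csvBracket_jacobi (x y z : SVGen × ℤ) (l m : ℂ) :
    (sesq csvBracket).ev l (Finsupp.single x 1)
        ((sesq csvBracket).ev m (Finsupp.single y 1) (Finsupp.single z 1)) -
      (sesq csvBracket).ev m (Finsupp.single y 1)
        ((sesq csvBracket).ev l (Finsupp.single x 1) (Finsupp.single z 1)) =
      (sesq csvBracket).ev (l + m)
        ((sesq csvBracket).ev l (Finsupp.single x 1) (Finsupp.single y 1))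
        (Finsupp.single z 1) := by
  obtain ⟨x, i⟩ := x
  obtain ⟨y, j⟩ := y
  obtain ⟨z, k⟩ := z
  have hk : j + (i + k) = i + (j + k) := by ring
  have hl : i + j + k = i + (j + k) := by ring
  cases x <;> cases y <;> cases z <;>
    simp only [csvBracket, sesq_ev_single, Finsupp.mapRange_single, Finsupp.mapRange_zero,
      Finsupp.smul_single, smul_zero, map_zero, LinearMap.zero_apply, sub_zero,
      ← Finsupp.single_sub, hk, hl] <;>
    (refine congrArg (Finsupp.single _) (Polynomial.funext fun x => ?_)
     simp
     try ring)

theorem extCsvBracket_skew (x y : ExtSVGen × ℤ) (t : ℂ) :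
    Finsupp.mapRange (Polynomial.eval (C t)) eval_zero (extCsvBracket x y) =
      -Finsupp.mapRange (Polynomial.eval (-C t - X)) eval_zero (extCsvBracket y x) := by
  obtain ⟨x, i⟩ := x
  obtain ⟨y, j⟩ := y
  cases x <;> cases y <;>
    simp only [extCsvBracket, Finsupp.mapRange_single, Finsupp.mapRange_zero, neg_zero,
      ← Finsupp.single_neg, add_comm j i] <;>
    (refine congrArg (Finsupp.single _) (Polynomial.funext fun x => ?_)
     simp
     try ring)

theorem extCsvBracket_jacobi (x y z : ExtSVGen × ℤ) (l m : ℂ) :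
    (sesq extCsvBracket).ev l (Finsupp.single x 1)
        ((sesq extCsvBracket).ev m (Finsupp.single y 1) (Finsupp.single z 1)) -
      (sesq extCsvBracket).ev m (Finsupp.single y 1)
        ((sesq extCsvBracket).ev l (Finsupp.single x 1) (Finsupp.single z 1)) =
      (sesq extCsvBracket).ev (l + m)
        ((sesq extCsvBracket).ev l (Finsupp.single x 1) (Finsupp.single y 1))
        (Finsupp.single z 1) := by
  obtain ⟨x, i⟩ := x
  obtain ⟨y, j⟩ := y
  obtain ⟨z, k⟩ := z
  have hk : j + (i + k) = i + (j + k) := by ring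
  have hl : i + j + k = i + (j + k) := by ring
  cases x <;> cases y <;> cases z <;>
    simp only [extCsvBracket, sesq_ev_single, Finsupp.mapRange_single, Finsupp.mapRange_zero,
      Finsupp.smul_single, smul_zero, map_zero, LinearMap.zero_apply, sub_zero, zero_sub,
      ← Finsupp.single_neg, ← Finsupp.single_sub, hk, hl] <;>
    first
    | (refine congrArg (Finsupp.single _) (Polynomial.funext fun x => ?_)
       simp
       try ring)
    | (refine Finsupp.single_eq_zero.2 (Polynomial.funext fun x => ?_)
       simp
       try ring)

/-- The loop Schrödinger-Virasoro Lie conformal algebra. -/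
instance : LieConformalAlgebra Csv where
  bracket := sesq csvBracket
  bracket_del_left := sesq_del_left _
  bracket_del_right := sesq_del_right _
  skew := sesq_skew _ csvBracket_skew
  jacobi a b c l m := by
    rw [← sesq_commutator _ _ csvBracket_jacobi, sub_add_cancel]

/-- The extended loop Schrödinger-Virasoro Lie conformal algebra. -/
instance : LieConformalAlgebra ExtCsv where
  bracket := sesq extCsvBracket
  bracket_del_left := sesq_del_left _
  bracket_del_right := sesq_del_right _
  skew := sesq_skew _ extCsvBracket_skew
  jacobi a b c l m := by
    rw [← sesq_commutator _ _ extCsvBracket_jacobi, sub_add_cancel]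

/-- The component of degree `i` in a free `ℂ[∂]`-module with basis `gᵢ` (`g ∈ γ`, `i ∈ ℤ`): the
direct sum of the `ℂ[∂]gᵢ`, `g ∈ γ`. -/
def degreePiece (γ : Type*) (i : ℤ) : Submodule ℂ[X] (γ × ℤ →₀ ℂ[X]) :=
  Finsupp.supported ℂ[X] ℂ[X] {x : γ × ℤ | x.2 = i}

theorem degreePiece_isInternal (γ : Type*) : DirectSum.IsInternal (degreePiece γ) := by
  classical
  rw [DirectSum.isInternal_submodule_iff_iSupIndep_and_iSup_eq_top]
  constructor
  · intro i
    have h : (⨆ j, ⨆ (_ : j ≠ i), degreePiece γ j) ≤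
        Finsupp.supported ℂ[X] ℂ[X] {x : γ × ℤ | x.2 ≠ i} :=
      iSup₂_le fun j hj => Finsupp.supported_mono fun x hx => by
        simp only [Set.mem_ofPred_eq] at hx ⊢
        rwa [hx]
    refine Disjoint.mono_right h (Finsupp.disjoint_supported_supported ?_)
    rw [Set.disjoint_left]
    exact fun x hx hx' => hx' hx
  · refine eq_top_iff.2 fun a _ => ?_
    rw [← Finsupp.sum_single a]
    refine Submodule.sum_mem _ fun x _ => ?_
    exact Submodule.mem_iSup_of_mem x.2 (Finsupp.single_mem_supported _ _ rfl)

theorem toLam_coeff_apply {κ : Type*} (P : κ →₀ ℂ[X][X]) (n : ℕ) (k : κ) :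
    (toLam κ P).coeff n k = (P k).coeff n := by
  classical
  induction P using Finsupp.induction_linear with
  | zero => simp
  | add P Q hP hQ => simp [hP, hQ]
  | single k' P =>
    induction P using Polynomial.induction_on' with
    | add P Q hP hQ => simp only [Finsupp.single_add, map_add, PolynomialModule.coeff_add,
        Finsupp.add_apply, hP, hQ, coeff_add]
    | monomial m a =>
      simp only [toLam, Finsupp.lsum_single, LinearMap.comp_apply, LinearEquiv.coe_coe,
        PolynomialModule.equivPolynomial_symm_monomial, PolynomialModule.map_single,
        PolynomialModule.coeff_single, Finsupp.lsingle_apply, Finsupp.single_apply,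
        apply_ite (fun f : κ →₀ ℂ[X] => f k)]
      by_cases h : m = n <;> by_cases h' : k' = k <;> simp [h, h', coeff_monomial]

theorem sesq_mem_supported {ι κ : Type*} (c : ι → κ → κ →₀ ℂ[X][X]) (S : Set ι) (T T' : Set κ)
    (h : ∀ i ∈ S, ∀ k ∈ T, ∀ k', c i k k' ≠ 0 → k' ∈ T')
    (a : ι →₀ ℂ[X]) (ha : a ∈ Finsupp.supported ℂ[X] ℂ[X] S)
    (v : κ →₀ ℂ[X]) (hv : v ∈ Finsupp.supported ℂ[X] ℂ[X] T) (n : ℕ) :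
    (sesq c a v).coeff n ∈ Finsupp.supported ℂ[X] ℂ[X] T' := by
  rw [← Finsupp.sum_single a, ← Finsupp.sum_single v]
  simp only [Finsupp.sum, map_sum, LinearMap.sum_apply, PolynomialModule.coeff_sum,
    Finsupp.finsetSum_apply]
  refine Submodule.sum_mem _ fun k hk => Submodule.sum_mem _ fun i hi => ?_
  rw [Finsupp.mem_supported']
  intro k' hk'
  have h0 : c i k k' = 0 := by
    by_contra hne
    exact hk' (h i (ha hi) k (hv hk) k' hne)
  rw [sesq_single, toLam_coeff_apply, Finsupp.smul_apply, h0, smul_zero, coeff_zero]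

theorem csv_isZGrading : IsZGrading (R := Csv) (degreePiece SVGen) where
  isInternal := degreePiece_isInternal _
  bracket_mem i j a ha b hb n := by
    refine sesq_mem_supported csvBracket _ _ _ ?_ a ha b hb n
    rintro ⟨x, i⟩ rfl ⟨y, j⟩ rfl z hz
    cases x <;> cases y <;> simp only [csvBracket, Finsupp.single_apply_ne_zero,
      Finsupp.coe_zero, Pi.zero_apply, ne_eq, not_true] at hz <;>
      exact hz.1 ▸ rfl

theorem extCsv_isZGrading : IsZGrading (R := ExtCsv) (degreePiece ExtSVGen) where
  isInternal := degreePiece_isInternal _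
  bracket_mem i j a ha b hb n := by
    refine sesq_mem_supported extCsvBracket _ _ _ ?_ a ha b hb n
    rintro ⟨x, i⟩ rfl ⟨y, j⟩ rfl z hz
    cases x <;> cases y <;> simp only [extCsvBracket, Finsupp.single_apply_ne_zero,
      Finsupp.coe_zero, Pi.zero_apply, ne_eq, not_true] at hz <;>
      exact hz.1 ▸ rfl

/-! ### The intermediate series -/

/-- `L_i λ v_m = (∂ + aλ + b) v_{i+m}`. -/
def densityCoeff (a b : ℂ) (_i _m : ℤ) : ℂ[X][X] := del + cst a * lam + cst b

/-- The coefficient of `v_{i+m}` in `L_i λ v_m` for a `0`-`1` sequence `A`. -/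
def twoStateCoeff (A : ℤ → Fin 2) (b : ℂ) (i m : ℤ) : ℂ[X][X] :=
  match A m, A (i + m) with
  | 0, 0 => del + cst b
  | 1, 1 => del + cst b + lam
  | 0, 1 => 1
  | 1, 0 => (del + cst b) * (del + cst b + lam)

/-- The `λ`-action of `Csv` on `⨁ ℂ[∂]v_m` with `L_i λ v_m = f_{i,m}(∂, λ) v_{i+m}`, while all
`M_i` and `Y_i` act by zero. -/
def csvAction (f : ℤ → ℤ → ℂ[X][X]) : LambdaMap Csv (ℤ →₀ ℂ[X]) :=
  sesq fun x m => match x with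
    | (.L, i) => Finsupp.single (i + m) (f i m)
    | (.M, _) => 0
    | (.Y, _) => 0

/-- The `λ`-action of `ExtCsv` on `⨁ ℂ[∂]v_m` with `L_i λ v_m = f_{i,m}(∂, λ) v_{i+m}` and
`N_i λ v_m = d v_{i+m}`, while all `M_i` and `Y_i` act by zero. -/
def extCsvAction (f : ℤ → ℤ → ℂ[X][X]) (d : ℂ) : LambdaMap ExtCsv (ℤ →₀ ℂ[X]) :=
  sesq fun x m => match x with
    | (.L, i) => Finsupp.single (i + m) (f i m)
    | (.M, _) => 0
    | (.Y, _) => 0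
    | (.N, i) => Finsupp.single (i + m) (cst d)

end

/-! After a choice of one generator per degree, a module is a family of polynomials in `∂` and `λ`,
and the commutator axiom becomes a system of functional equations between them. The generators `L_i`
and `g_j`, with `g` of conformal weight `κ + 1`, give the single relation `IsPrimary κ`.

The `L_0` alone makes each component a rank one Virasoro module, so `L_0` acts on `v_m` by `0` or by
`∂ + b + a_m λ` (`virasoro_rank_one`). Nontriviality spreads from one component to all of them, with
the same `b`. Shift `∂` so that `b = 0` and differentiate the relation with `L_0` at `λ = 0`: the
result is Euler's equation, so the coefficient of `g_j` on `v_m` is homogeneous of degree `κ + a_m -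
a_{j+m}` (`IsPrimary.euler`).

Everything follows from these degrees. For `L_i` they are natural numbers, and the degrees of a
passage and of its reverse add up to `2`; the pair `(2, 0)` is possible only between the weights `1`
and `0`. Hence the `a_m` are all equal or all lie in `{0, 1}`, and the coefficients are the standard
ones up to scalars, which a rescaling of the generators removes (`IsPrimary.exists_rescaling`). For
`Y_j` the degree is a half-integer, so `Y` acts by zero, and `M` does too because of `[Y_i λ Y_j]`.
For `N_j` the relation with `N_0` leaves one scalar `d` (`IsPrimary.exists_scalar`). -/

/-! ### Polynomials in `∂` and `λ`: values, shears, derivatives and Euler's equation. -/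

theorem evalEval_eq_zero_iff {P : ℂ[X][X]} : (∀ x y, P.evalEval x y = 0) ↔ P = 0 := by
  refine ⟨fun h => ?_, fun h x y => by simp [h]⟩
  refine Polynomial.eq_zero_of_infinite_isRoot P
    ((Set.infinite_range_of_injective (C_injective (R := ℂ))).mono ?_)
  rintro _ ⟨t, rfl⟩
  exact Polynomial.funext fun x => by simpa [evalEval] using h x t

theorem evalEval_inj {P Q : ℂ[X][X]} : (∀ x y, P.evalEval x y = Q.evalEval x y) ↔ P = Q := by
  rw [← sub_eq_zero (a := P), ← evalEval_eq_zero_iff]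
  simp [sub_eq_zero]

/-- The substitution of `∂ + αλ + β` for `∂`. -/
noncomputable def shear (α β : ℂ) (P : ℂ[X][X]) : ℂ[X][X] :=
  P.eval₂ (aeval (C X + C (C α) * X + C (C β))).toRingHom X

theorem evalEval_shear (α β : ℂ) (P : ℂ[X][X]) (x y : ℂ) :
    (shear α β P).evalEval x y = P.evalEval (x + α * y + β) y := by
  unfold shear
  induction P using Polynomial.induction_on' with
  | add P Q hP hQ => rw [eval₂_add, evalEval_add, hP, hQ, evalEval_add]
  | monomial n p =>
    rw [eval₂_monomial, ← C_mul_X_pow_eq_monomial]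
    simp only [evalEval_mul, evalEval_pow, evalEval_X, evalEval_C]
    congr 1
    induction p using Polynomial.induction_on' with
    | add p q hp hq => simp_all
    | monomial n a =>
      rw [← C_mul_X_pow_eq_monomial]
      simp [evalEval_C, ← Polynomial.algebraMap_eq, IsScalarTower.algebraMap_apply ℂ ℂ[X] ℂ[X][X]]

theorem shear_eq_zero_iff {α β : ℂ} {P : ℂ[X][X]} : shear α β P = 0 ↔ P = 0 := by
  rw [← evalEval_eq_zero_iff, ← evalEval_eq_zero_iff]
  simp only [evalEval_shear]
  refine ⟨fun h x y => ?_, fun h x y => h _ _⟩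
  convert h (x - α * y - β) y using 2
  ring

/-- The partial derivative with respect to `∂`. -/
noncomputable def derivDel (P : ℂ[X][X]) : ℂ[X][X] :=
  P.sum fun n p => monomial n (derivative p)

theorem coeff_derivDel (P : ℂ[X][X]) (n : ℕ) : (derivDel P).coeff n = derivative (P.coeff n) := by
  simp only [derivDel, Polynomial.sum, finsetSum_coeff, coeff_monomial]
  simp only [Finset.sum_ite_eq', mem_support_iff]
  split_ifs with h
  · rfl
  · simp [not_not.1 h]

theorem derivDel_add (P Q : ℂ[X][X]) : derivDel (P + Q) = derivDel P + derivDel Q := by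
  ext1 n; simp [coeff_derivDel]

theorem hasDerivAt_evalEval_left (P : ℂ[X][X]) (x y : ℂ) :
    HasDerivAt (fun x => P.evalEval x y) ((derivDel P).evalEval x y) x := by
  induction P using Polynomial.induction_on' with
  | add P Q hP hQ => simpa [derivDel_add] using hP.fun_add hQ
  | monomial n p =>
    have : derivDel (monomial n p) = monomial n (derivative p) := by
      ext1 k; simp only [coeff_derivDel, coeff_monomial]; split_ifs <;> simp
    rw [this]
    simp only [evalEval, eval_monomial, eval_mul, ← C_pow, eval_C]
    exact (p.hasDerivAt x).mul_const _

theorem hasDerivAt_evalEval_right (P : ℂ[X][X]) (x y : ℂ) :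
    HasDerivAt (fun y => P.evalEval x y) ((derivative P).evalEval x y) y := by
  induction P using Polynomial.induction_on' with
  | add P Q hP hQ => simpa using hP.fun_add hQ
  | monomial n p =>
    rw [← C_mul_X_pow_eq_monomial]
    simp only [evalEval_mul, evalEval_pow, evalEval_X, evalEval_C, derivative_mul, derivative_C,
      derivative_X_pow, zero_mul, zero_add]
    simpa [evalEval_C] using (hasDerivAt_pow n y).const_mul (p.eval x)

/-- Both sides are differentiated in `l` at `l = 0`. With `A` and `B` the coefficients of `L_0` on
target and source, this linearizes the relation into a first-order equation for `G`. -/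
theorem deriv_of_relation {G A B : ℂ[X][X]} {κ : ℂ}
    (h : ∀ x l m, G.evalEval (x + l) m * A.evalEval x l - B.evalEval (x + m) l * G.evalEval x m =
      (κ * l - m) * G.evalEval x (l + m)) (x m : ℂ) :
    (derivDel G).evalEval x m * A.evalEval x 0 + G.evalEval x m * (derivative A).evalEval x 0 -
      (derivative B).evalEval (x + m) 0 * G.evalEval x m =
      κ * G.evalEval x m - m * (derivative G).evalEval x m := by
  have h1 : HasDerivAt (fun l => G.evalEval (x + l) m) ((derivDel G).evalEval x m) 0 := by
    simpa using HasDerivAt.comp_const_add x 0 (by simpa using hasDerivAt_evalEval_left G x m)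
  have h2 : HasDerivAt (fun l => G.evalEval x (l + m)) ((derivative G).evalEval x m) 0 := by
    simpa using HasDerivAt.comp_add_const 0 m (by simpa using hasDerivAt_evalEval_right G x m)
  have h3 := (h1.mul (hasDerivAt_evalEval_right A x 0)).sub
    ((hasDerivAt_evalEval_right B (x + m) 0).mul_const (G.evalEval x m))
  have h4 := (((hasDerivAt_id (0 : ℂ)).const_mul κ).sub_const m).mul h2
  have h5 := h3.unique (h4.congr_of_eventuallyEq (Filter.Eventually.of_forall fun l => h x l m))
  simpa [sub_eq_add_neg] using h5

/-- The monomial `∂ᵏ λˡ` is an eigenvector of the Euler operator with eigenvalue `k + l`. The degree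
`n` is complex, since it will be a difference of unknown weights. -/
theorem coeff_eq_zero_of_euler {P : ℂ[X][X]} {n : ℂ}
    (h : ∀ x y, (derivDel P).evalEval x y * x + y * (derivative P).evalEval x y =
      n * P.evalEval x y) {k l : ℕ} (hkl : (k + l : ℂ) ≠ n) : (P.coeff l).coeff k = 0 := by
  have h1 : derivDel P * C X + X * derivative P = C (C n) * P := by
    rw [← evalEval_inj]
    intro x y
    simpa [evalEval_C] using h x y
  have h2 := congrArg (fun Q : ℂ[X][X] => (Q.coeff l).coeff k) h1
  have h3 : ((derivDel P * C X).coeff l).coeff k = k * (P.coeff l).coeff k := by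
    rw [coeff_mul_C, coeff_derivDel]
    cases k with
    | zero => simp
    | succ k => rw [coeff_mul_X, coeff_derivative]; push_cast; ring
  have h4 : ((X * derivative P).coeff l).coeff k = l * (P.coeff l).coeff k := by
    cases l with
    | zero => simp
    | succ l =>
      rw [coeff_X_mul, coeff_derivative, ← Nat.cast_succ, mul_comm, ← nsmul_eq_mul, coeff_smul]
      simp
  simp only [coeff_add, h3, h4, coeff_C_mul] at h2
  have : ((k + l : ℂ) - n) * (P.coeff l).coeff k = 0 := by linear_combination h2
  exact (mul_eq_zero.1 this).resolve_left (sub_ne_zero.2 hkl)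

theorem eq_zero_of_euler {P : ℂ[X][X]} {n : ℂ}
    (h : ∀ x y, (derivDel P).evalEval x y * x + y * (derivative P).evalEval x y =
      n * P.evalEval x y) (hn : ∀ k : ℕ, (k : ℂ) ≠ n) : P = 0 := by
  ext l k
  exact coeff_eq_zero_of_euler h (by exact_mod_cast hn (k + l))

theorem eval_eq_sum_of_euler {P : ℂ[X][X]} {n : ℕ}
    (h : ∀ x y, (derivDel P).evalEval x y * x + y * (derivative P).evalEval x y =
      n * P.evalEval x y) :
    ∃ c : ℕ → ℂ, ∀ x y, P.evalEval x y =
      ∑ l ∈ Finset.range (n + 1), c l * x ^ (n - l) * y ^ l := by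
  refine ⟨fun l => (P.coeff l).coeff (n - l), fun x y => ?_⟩
  have hz : ∀ k l : ℕ, k + l ≠ n → (P.coeff l).coeff k = 0 := fun k l hkl =>
    coeff_eq_zero_of_euler h (by exact_mod_cast hkl)
  have hd : P.natDegree < n + 1 := by
    rw [Nat.lt_succ_iff, natDegree_le_iff_coeff_eq_zero]
    intro l hl
    ext k
    exact hz k l (by omega)
  rw [evalEval, eval_eq_sum_range' hd, eval_finsetSum]
  refine Finset.sum_congr rfl fun l hl => ?_
  have : P.coeff l = monomial (n - l) ((P.coeff l).coeff (n - l)) := by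
    ext k
    rw [coeff_monomial]
    split_ifs with hk
    · rw [hk]
    · exact hz k l (by simp at hl; omega)
  rw [eval_mul, ← C_pow, eval_C, this, eval_monomial]

/-! ### Rank one modules over the Virasoro conformal algebra. -/

/-- The free rank one conformal modules over the Virasoro conformal algebra. -/
theorem virasoro_rank_one {F : ℂ[X][X]}
    (h : ∀ x l m, F.evalEval (x + l) m * F.evalEval x l - F.evalEval (x + m) l * F.evalEval x m =
      (l - m) * F.evalEval x (l + m)) :
    F = 0 ∨ ∃ a b : ℂ, ∀ x y, F.evalEval x y = x + b + a * y := by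
  by_cases hF : F = 0
  · exact .inl hF
  right
  obtain ⟨b, hb⟩ : ∃ b, ∀ x, F.evalEval x 0 = x + b := by
    -- The relation at `m = 0`. Cancelling `F` leaves `F(x + l, 0) - F(x, 0) = l`.
    have h1 : F * (shear 1 0 (C (F.eval 0)) - C (F.eval 0) - X) = 0 := by
      rw [← evalEval_eq_zero_iff]
      intro x l
      have := h x l 0
      simp only [evalEval_mul, evalEval_sub, evalEval_shear, evalEval_C, evalEval_X]
      simp only [evalEval, add_zero, C_0, one_mul, sub_zero] at this ⊢
      linear_combination this
    refine ⟨F.evalEval 0 0, fun x => ?_⟩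
    have := evalEval_eq_zero_iff.2 ((mul_eq_zero.1 h1).resolve_left hF) 0 x
    simp only [evalEval_sub, evalEval_shear, evalEval_C, evalEval_X] at this
    simp only [evalEval, C_0, one_mul, add_zero, zero_add] at this ⊢
    linear_combination this
  set G := shear 0 (-b) F with hG
  have hGe : ∀ x y, G.evalEval x y = F.evalEval (x - b) y := fun x y => by
    rw [hG, evalEval_shear]; ring_nf
  have hG0 : ∀ x, G.evalEval x 0 = x := fun x => by rw [hGe, hb]; ring
  have hGne : G ≠ 0 := fun h0 => hF (shear_eq_zero_iff.1 h0)
  have hd := deriv_of_relation (G := G) (A := G) (B := G) (κ := 1) fun x l m => by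
    have := h (x - b) l m
    simp only [hGe, one_mul]
    rw [← this]; ring_nf
  simp only [hG0, one_mul] at hd
  set u : ℂ[X] := (derivative G).eval 0 with hu
  have hue : ∀ x, (derivative G).evalEval x 0 = u.eval x := fun x => by simp [evalEval, hu]
  simp only [hue] at hd
  -- Euler's equation with the extra factor `u(∂ + λ) + 1 - u(∂)` in place of a constant. The left
  -- side has `λ`-degree at most that of `G`, while the factor has `λ`-degree `deg u`; so `u` is
  -- constant and `G` is homogeneous of degree `1`.
  have hpoly : derivDel G * C X + X * derivative G =
      G * (shear 1 0 (C u) + C (1 - u)) := by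
    rw [← evalEval_inj]
    intro x y
    simp only [evalEval_add, evalEval_mul, evalEval_C, evalEval_X, eval_X, evalEval_shear,
      eval_sub, eval_one]
    have := hd x y
    simp only [one_mul, add_zero]
    linear_combination this
  have hsh : (shear 1 0 (C u)).natDegree = u.natDegree := by
    have : shear 1 0 (C u) = (u.map C).comp (X + C X) := by
      simp only [shear, eval₂_C, comp, eval₂_map, AlgHom.toRingHom_eq_coe, RingHom.coe_coe,
        aeval_def, C_1, C_0, one_mul, add_zero, add_comm (C X)]
      rfl
    rw [this, natDegree_comp, natDegree_X_add_C, mul_one, natDegree_map_eq_of_injective C_injective]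
  have hdeg : (shear 1 0 (C u) + C (1 - u)).natDegree = u.natDegree := by
    rw [natDegree_add_C, hsh]
  have hu0 : u.natDegree = 0 := by
    by_contra hne
    have hne' : shear 1 0 (C u) + C (1 - u) ≠ 0 := fun h0 => by
      rw [h0, natDegree_zero] at hdeg; exact hne hdeg.symm
    have h1 := congrArg natDegree hpoly
    rw [natDegree_mul hGne hne', hdeg] at h1
    have h2 : (derivDel G * C X + X * derivative G).natDegree ≤ G.natDegree := by
      refine natDegree_add_le_of_degree_le ?_ ?_
      · refine (natDegree_mul_C_le _ _).trans ?_
        rw [natDegree_le_iff_coeff_eq_zero]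
        intro n hn
        rw [coeff_derivDel, coeff_eq_zero_of_natDegree_lt hn, derivative_zero]
      · rw [natDegree_le_iff_coeff_eq_zero]
        rintro (_ | n) hn
        · simp
        · rw [coeff_X_mul, coeff_derivative, coeff_eq_zero_of_natDegree_lt hn, zero_mul]
    omega
  obtain ⟨a, ha⟩ : ∃ a, u = C a := ⟨_, eq_C_of_natDegree_eq_zero hu0⟩
  simp only [ha, eval_C] at hd
  obtain ⟨c, hc⟩ := eval_eq_sum_of_euler (P := G) (n := 1) fun x y => by
    have := hd x y
    push_cast
    linear_combination this
  simp only [Finset.sum_range_succ, Finset.sum_range_zero, zero_add, tsub_zero, pow_one, pow_zero,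
    mul_one, tsub_self] at hc
  have hc0 : c 0 = 1 := by
    have := hc 1 0
    rw [hG0] at this
    linear_combination -this
  refine ⟨c 1, b, fun x y => ?_⟩
  have := hc (x + b) y
  rw [hGe, hc0, add_sub_cancel_right] at this
  linear_combination this

/-! ### The relation with the `L_i`, and the action of `L_0` on all components. -/

/-- The identity satisfied by the coefficients `f` of the action of the `L_i` and the coefficients
`g` of the action of generators `x_j` with `[L_i λ x_j] = (∂ + (κ + 1)λ) x_{i+j}`. -/
def IsPrimary (κ : ℂ) (f g : ℤ → ℤ → ℂ[X][X]) : Prop :=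
  ∀ (i j m : ℤ) (x l u : ℂ),
    (g j m).evalEval (x + l) u * (f i (j + m)).evalEval x l -
      (f i m).evalEval (x + u) l * (g j (i + m)).evalEval x u =
    (κ * l - u) * (g (i + j) m).evalEval x (l + u)

theorem IsPrimary.shear {κ : ℂ} {f g : ℤ → ℤ → ℂ[X][X]} (h : IsPrimary κ f g) (b : ℂ) :
    IsPrimary κ (fun i m => shear 0 b (f i m)) (fun i m => shear 0 b (g i m)) := by
  intro i j m x l u
  have := h i j m (x + b) l u
  simp only [evalEval_shear, zero_mul, add_zero]
  rw [← this]
  ring_nf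

theorem IsPrimary.zero_eq {f : ℤ → ℤ → ℂ[X][X]} (h : IsPrimary 1 f f) (m : ℤ) :
    f 0 m = 0 ∨ ∃ a b : ℂ, ∀ x y, (f 0 m).evalEval x y = x + b + a * y :=
  virasoro_rank_one fun x l u => by simpa using h 0 0 m x l u

/-- A linear polynomial `x + β y + γ` is not a zero divisor. -/
theorem eq_zero_of_linear_mul {P : ℂ[X][X]} {β γ : ℂ}
    (h : ∀ x y, (x + β * y + γ) * P.evalEval x y = 0) : P = 0 := by
  have h1 : (C X + C (C β) * X + C (C γ)) * P = 0 := by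
    rw [← evalEval_eq_zero_iff]
    intro x y
    simpa [evalEval_C] using h x y
  refine (mul_eq_zero.1 h1).resolve_left fun h2 => ?_
  have h3 := evalEval_eq_zero_iff.2 h2
  have h4 := h3 0 0
  have h5 := h3 1 0
  simp [evalEval_C] at h4 h5
  simp [h4] at h5

/-- At `i = 0`, `l = 0` the relation says that `g j m` is killed by a combination of `λ` and the
values of the two `L_0`-coefficients at `λ = 0`. If either coefficient vanished, this multiplier
would be a nonzero linear polynomial; if neither does, it is the difference of the two constants
`b`. -/
theorem IsPrimary.exists_of_ne_zero {κ : ℂ} {f g : ℤ → ℤ → ℂ[X][X]} (hf : IsPrimary 1 f f)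
    (h : IsPrimary κ f g) {j m : ℤ} (hg : g j m ≠ 0) :
    ∃ a a' b : ℂ, (∀ x y, (f 0 m).evalEval x y = x + b + a * y) ∧
      ∀ x y, (f 0 (j + m)).evalEval x y = x + b + a' * y := by
  have h0 := h 0 j m
  simp only [zero_add] at h0
  obtain hm | ⟨a, b, hm⟩ := hf.zero_eq m <;> obtain hm' | ⟨a', b', hm'⟩ := hf.zero_eq (j + m)
  · have h1 : X * g j m = 0 := by
      rw [← evalEval_eq_zero_iff]
      intro x y
      have := h0 x 0 y
      simp only [hm, hm', evalEval_zero, zero_add] at this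
      simp only [evalEval_mul, evalEval_X]
      linear_combination this
    exact absurd ((mul_eq_zero.1 h1).resolve_left X_ne_zero) hg
  · refine absurd (eq_zero_of_linear_mul (β := 1) (γ := b') fun x y => ?_) hg
    have := h0 x 0 y
    simp only [hm, hm', evalEval_zero] at this
    simp only [add_zero, zero_add] at this
    linear_combination this
  · refine absurd (eq_zero_of_linear_mul (β := 0) (γ := b) fun x y => ?_) hg
    have := h0 x 0 y
    simp only [hm, hm', evalEval_zero] at this
    simp only [add_zero, zero_add] at this
    linear_combination -this
  · refine ⟨a, a', b, hm, ?_⟩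
    have h1 : C (C (b' - b)) * g j m = 0 := by
      rw [← evalEval_eq_zero_iff]
      intro x y
      have := h0 x 0 y
      simp only [hm, hm', add_zero, zero_add] at this
      simp only [evalEval_mul, evalEval_C, eval_C]
      linear_combination this
    have h2 := (mul_eq_zero.1 h1).resolve_right hg
    rw [C_eq_zero, C_eq_zero, sub_eq_zero] at h2
    rw [← h2]
    exact hm'

/-- If `L_0` does not annihilate `v_m`, then no `L_i` does. -/
theorem IsPrimary.ne_zero_of_zero_ne_zero {f : ℤ → ℤ → ℂ[X][X]} (hf : IsPrimary 1 f f) {m : ℤ}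
    (hm : f 0 m ≠ 0) (i : ℤ) : f i m ≠ 0 := by
  intro hi
  have h0 := hf (-i) i m
  simp only [hi, evalEval_zero, zero_mul, zero_sub, neg_add_cancel] at h0
  -- At `l = u` the right side of the relation for `[L_{-i} λ L_i]` vanishes, so one of the two
  -- factors is zero as a polynomial. The relation then makes `(l - u) f_{0,m}(x, l + u)` vanish
  -- identically.
  have h1 : _root_.shear 1 0 (f (-i) m) * f i (-i + m) = 0 := by
    rw [← evalEval_eq_zero_iff]
    intro x y
    have := h0 x y y
    simp only [evalEval_mul, evalEval_shear]
    simp only [one_mul, add_zero] at this ⊢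
    linear_combination -this
  obtain ⟨a, b, hab⟩ := (hf.zero_eq m).resolve_left hm
  have h2 : ∀ x l u, (l - u) * (f 0 m).evalEval x (l + u) = 0 := by
    intro x l u
    rcases mul_eq_zero.1 h1 with h | h
    · have := h0 x l u
      rw [shear_eq_zero_iff] at h
      rw [h] at this
      simp at this
      simp [this]
    · have := h0 x l u
      rw [h] at this
      simp at this
      simp [this]
  have h3 := h2 (1 - b) 1 0
  have h4 := h2 (1 - b) 1 (-1)
  simp [hab] at h3 h4

theorem IsPrimary.exists_zero_eq {f : ℤ → ℤ → ℂ[X][X]} (hf : IsPrimary 1 f f) {m₀ : ℤ}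
    (h0 : f 0 m₀ ≠ 0) :
    ∃ (b : ℂ) (a : ℤ → ℂ), ∀ m x y, (f 0 m).evalEval x y = x + b + a m * y := by
  obtain ⟨a₀, b, hab⟩ := (hf.zero_eq m₀).resolve_left h0
  have : ∀ m, ∃ a : ℂ, ∀ x y, (f 0 m).evalEval x y = x + b + a * y := by
    intro m
    obtain ⟨a, a', b', h1, h2⟩ :=
      hf.exists_of_ne_zero hf (hf.ne_zero_of_zero_ne_zero h0 (m - m₀))
    rw [sub_add_cancel] at h2
    refine ⟨a', fun x y => ?_⟩
    have h3 := h1 0 0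
    rw [hab] at h3
    rw [h2]
    linear_combination -h3
  choose a ha using this
  exact ⟨b, a, ha⟩

/-! ### Homogeneity and the coefficients of the `L_i`. -/

/-- The linear part of `L_0` in `λ` acts as a degree operator: this is `deriv_of_relation` for `i =
0`, where the value of `L_0` at `λ = 0` is `∂` itself. -/
theorem IsPrimary.euler {κ : ℂ} {f g : ℤ → ℤ → ℂ[X][X]} (h : IsPrimary κ f g) {a : ℤ → ℂ}
    (h0 : ∀ m x y, (f 0 m).evalEval x y = x + a m * y) (j m : ℤ) (x y : ℂ) :
    (derivDel (g j m)).evalEval x y * x + y * (derivative (g j m)).evalEval x y =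
      (κ + a m - a (j + m)) * (g j m).evalEval x y := by
  have hd : ∀ m x, (derivative (f 0 m)).evalEval x 0 = a m := by
    intro m x
    have : f 0 m = C X + C (C (a m)) * X := by
      rw [← evalEval_inj]
      intro x y
      simp [h0, evalEval_C]
    simp [this, evalEval_C]
  have h1 := deriv_of_relation (G := g j m) (A := f 0 (j + m)) (B := f 0 m) (κ := κ)
    (fun x l u => by simpa using h 0 j m x l u) x y
  simp only [h0, hd, mul_zero, add_zero] at h1
  linear_combination h1

/-- The coefficient of the normalized action of `L_i` between components of weights `s` and `t`. -/
noncomputable def stdCoeff (s t x y : ℂ) : ℂ :=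
  open Classical in if s = t then x + s * y else if s = 0 then 1 else x * (x + y)

/-- The pairs of weights between which `L_i` can act injectively. -/
def Linked (s t : ℂ) : Prop := s = t ∨ (s = 0 ∧ t = 1) ∨ (s = 1 ∧ t = 0)

theorem exists_ne_zero_of_eval_eq_sum {P : ℂ[X][X]} (hP : P ≠ 0) {n : ℕ} {c : ℕ → ℂ}
    (hc : ∀ x y, P.evalEval x y = ∑ l ∈ Finset.range (n + 1), c l * x ^ (n - l) * y ^ l) :
    ∃ l ≤ n, c l ≠ 0 := by
  by_contra! hc0
  refine hP (evalEval_eq_zero_iff.1 fun x y => ?_)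
  rw [hc]
  refine Finset.sum_eq_zero fun l hl => ?_
  rw [hc0 l (by simp at hl; omega)]
  ring

/-- This is the case of degree `2`. The three coefficients of the quadratic form satisfy linear
equations coming from `L_0`, whose only nonzero solution occurs at `a m = 1`. -/
theorem IsPrimary.exists_coeff_of_eq_sub_one {f : ℤ → ℤ → ℂ[X][X]} (hf : IsPrimary 1 f f)
    {a : ℤ → ℂ} (h0 : ∀ m x y, (f 0 m).evalEval x y = x + a m * y) {i m : ℤ} (hne : f i m ≠ 0)
    (ht : a (i + m) = a m - 1) :
    a m = 1 ∧ ∃ c : ℂ, c ≠ 0 ∧ ∀ x y, (f i m).evalEval x y = c * (x * (x + y)) := by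
  obtain ⟨c, hc⟩ := eval_eq_sum_of_euler (P := f i m) (n := 2) fun x y => by
    rw [hf.euler h0, ht]
    push_cast
    ring
  obtain ⟨k, hk, hck⟩ := exists_ne_zero_of_eval_eq_sum hne hc
  have hrel := hf 0 i m
  simp only [zero_add, h0, ht] at hrel
  simp only [hc, Finset.sum_range_succ, Finset.sum_range_zero] at hrel
  simp only [zero_add, tsub_zero, tsub_self, pow_zero, mul_one, one_mul, Nat.add_one_sub_one,
    pow_one] at hrel
  -- The evaluation points isolate single coefficients of the relation; pairs with opposite `l` are
  -- averaged to keep its even part in `l`.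
  have e1 : (a m - 1) * c 0 = c 2 := by linear_combination hrel 0 1 0
  have e2 : (a m - 1) * c 1 = c 2 := by linear_combination (hrel 0 1 1 + hrel 0 (-1) 1) / 2
  have e3 : (2 * a m - 1) * c 0 = c 1 := by linear_combination (hrel 1 1 0 + hrel 1 (-1) 0) / 2
  have hc0 : c 0 ≠ 0 := fun hc0 => by
    have h1 : c 1 = 0 := by rw [← e3, hc0, mul_zero]
    have h2 : c 2 = 0 := by rw [← e1, hc0, mul_zero]
    interval_cases k <;> contradiction
  have ha : (a m - 1) ^ 2 * c 0 = 0 := by linear_combination (e2 - e1 + (a m - 1) * e3) / 2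
  have ha' : a m = 1 := by
    have := pow_eq_zero_iff (n := 2) (by norm_num) |>.1 ((mul_eq_zero.1 ha).resolve_right hc0)
    linear_combination this
  refine ⟨ha', c 0, hc0, fun x y => ?_⟩
  rw [ha'] at e1 e3
  rw [hc, Finset.sum_range_succ, Finset.sum_range_succ, Finset.sum_range_one, ← e1, ← e3]
  norm_num
  ring

theorem IsPrimary.exists_coeff {f : ℤ → ℤ → ℂ[X][X]} (hf : IsPrimary 1 f f) {a : ℤ → ℂ}
    (h0 : ∀ m x y, (f 0 m).evalEval x y = x + a m * y) (i m : ℤ) :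
    Linked (a m) (a (i + m)) ∧ ∃ c : ℂ, c ≠ 0 ∧
      ∀ x y, (f i m).evalEval x y = c * stdCoeff (a m) (a (i + m)) x y := by
  have hz : ∀ m, f 0 m ≠ 0 := fun m hm => by
    have := h0 m 1 0
    simp [hm] at this
  have hne : ∀ i m, f i m ≠ 0 := fun i m => hf.ne_zero_of_zero_ne_zero (hz m) i
  have hnat : ∀ i m, ∃ k : ℕ, (k : ℂ) = 1 + a m - a (i + m) := by
    intro i m
    by_contra! hk
    exact hne i m (eq_zero_of_euler (hf.euler h0 i m) hk)
  obtain ⟨k, hk⟩ := hnat i m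
  obtain ⟨k', hk'⟩ := hnat (-i) (i + m)
  rw [neg_add_cancel_left] at hk'
  -- The weights cancel between a passage and its reverse, and each of the two contributes `κ = 1`.
  have hkk : k + k' = 2 := by
    have : ((k + k' : ℕ) : ℂ) = 2 := by push_cast; rw [hk, hk']; ring
    exact_mod_cast this
  have hk2 : k ≤ 2 := by omega
  obtain ⟨c, hc⟩ := eval_eq_sum_of_euler (P := f i m) (n := k) (by
    rw [hk]; exact hf.euler h0 i m)
  obtain ⟨n, hn, hcn⟩ := exists_ne_zero_of_eval_eq_sum (hne i m) hc
  interval_cases k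
  · rw [Nat.cast_zero] at hk
    -- Degree `0` alone does not fix the weights; the reverse passage has degree `2` and does.
    have h1 := (hf.exists_coeff_of_eq_sub_one h0 (hne (-i) (i + m)) (by
      rw [neg_add_cancel_left]; linear_combination -hk)).1
    have h2 : a m = 0 := by linear_combination h1 - hk
    obtain rfl : n = 0 := by omega
    refine ⟨.inr (.inl ⟨h2, h1⟩), c 0, hcn, fun x y => ?_⟩
    rw [hc, h1, h2]
    simp [stdCoeff]
  · rw [Nat.cast_one] at hk
    have ht : a (i + m) = a m := by linear_combination hk
    have hrel := hf 0 i m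
    simp only [zero_add, h0, ht] at hrel
    simp only [hc, Finset.sum_range_succ, Finset.sum_range_zero] at hrel
    simp only [zero_add, tsub_zero, tsub_self, pow_zero, mul_one, one_mul, pow_one] at hrel
    have e : c 1 = a m * c 0 := by linear_combination -hrel 0 1 0
    have hc0 : c 0 ≠ 0 := fun hc0 => by
      rw [hc0, mul_zero] at e
      interval_cases n <;> contradiction
    refine ⟨.inl ht.symm, c 0, hc0, fun x y => ?_⟩
    rw [hc, ht, Finset.sum_range_succ, Finset.sum_range_one, e]
    simp [stdCoeff]
    ring
  · rw [Nat.cast_two] at hk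
    have ht : a (i + m) = a m - 1 := by linear_combination hk
    obtain ⟨h1, c', hc', h2⟩ := hf.exists_coeff_of_eq_sub_one h0 (hne i m) ht
    have h3 : a (i + m) = 0 := by rw [ht, h1, sub_self]
    refine ⟨.inr (.inr ⟨h1, h3⟩), c', hc', fun x y => ?_⟩
    rw [h2, h1, h3]
    simp [stdCoeff]

/-- A family of weights that are pairwise linked is constant or takes values in `{0, 1}`. -/
theorem eq_const_or_of_linked {a : ℤ → ℂ} (ha : ∀ m n, Linked (a m) (a n)) :
    (∃ α, ∀ m, a m = α) ∨ ∀ m, a m = 0 ∨ a m = 1 := by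
  by_cases h : ∃ m n, a m ≠ a n
  · obtain ⟨m, n, hmn⟩ := h
    right
    intro p
    have h1 := ha m n
    have h2 := ha p m
    have h3 := ha p n
    unfold Linked at h1 h2 h3
    grind
  · push Not at h
    exact .inl ⟨a 0, fun m => h m 0⟩

theorem stdCoeff_relation {a : ℤ → ℂ} (ha : ∀ m n, Linked (a m) (a n)) (p q r s : ℤ)
    (x l u : ℂ) :
    stdCoeff (a p) (a q) (x + l) u * stdCoeff (a q) (a s) x l -
      stdCoeff (a p) (a r) (x + u) l * stdCoeff (a r) (a s) x u =
    (l - u) * stdCoeff (a p) (a s) x (l + u) := by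
  obtain ⟨α, hα⟩ | h := eq_const_or_of_linked ha
  · simp only [hα, stdCoeff, if_true]
    ring
  · rcases h p with hp | hp <;> rcases h q with hq | hq <;> rcases h r with hr | hr <;>
      rcases h s with hs | hs <;> simp [hp, hq, hr, hs, stdCoeff] <;> ring

theorem stdCoeff_one_zero (s t : ℂ) : stdCoeff s t 1 0 = 1 := by
  unfold stdCoeff
  split_ifs <;> simp

/-- The coefficients of the action of the `L_i` are those of one of the standard modules, up to
rescaling of the generators. -/
theorem IsPrimary.exists_rescaling {f : ℤ → ℤ → ℂ[X][X]} (hf : IsPrimary 1 f f) {a : ℤ → ℂ}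
    (h0 : ∀ m x y, (f 0 m).evalEval x y = x + a m * y) :
    (∀ m n, Linked (a m) (a n)) ∧ ∃ c : ℤ → ℂ, (∀ m, c m ≠ 0) ∧ ∀ i m x y,
      c m * (f i m).evalEval x y = c (i + m) * stdCoeff (a m) (a (i + m)) x y := by
  have hL : ∀ m n, Linked (a m) (a n) := fun m n => by
    have := (hf.exists_coeff h0 (n - m) m).1
    rwa [sub_add_cancel] at this
  choose c hc hfc using fun i m => (hf.exists_coeff h0 i m).2
  -- The generator of degree `m` is normalized through the action of `L_m` on degree `0`. What
  -- remains is a cocycle identity for the scalars, obtained from `[L_i λ L_j]` on degree `0`.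
  refine ⟨hL, fun m => c m 0, fun m => hc m 0, fun i j x y => ?_⟩
  suffices h : c j 0 * c i j = c (i + j) 0 by
    simp only [hfc, ← h]; ring
  have hrel := hf i j 0
  have hstd := stdCoeff_relation hL 0 j i (i + j)
  simp only [hfc, add_zero] at hrel
  rw [add_comm j i] at hrel
  set p := c j 0 * c i j
  set q := c i 0 * c j i
  set r := c (i + j) 0
  have hpq : p = q := by
    have h1 := hrel 1 0 0
    simp only [add_zero, stdCoeff_one_zero] at h1
    linear_combination h1
  -- Here `l + u = 0` and `l - u = 2`, so the right side is `2 r` whatever the weights are.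
  -- Comparison with the same identity for the standard coefficients gives `2 p = 2 r`.
  have h1 := hrel 1 1 (-1)
  have h2 := hstd 1 1 (-1)
  rw [add_neg_cancel, stdCoeff_one_zero] at h1 h2
  linear_combination (h1 - p * h2 - hpq * (stdCoeff (a 0) (a i) 0 1 *
    stdCoeff (a i) (a (i + j)) 1 (-1))) / 2

/-! ### Primary fields of weight `3 / 2` and `1`. -/

/-- Linked weights differ by an integer, so the degree that `IsPrimary.euler` assigns to `Y_j` is a
proper half-integer. -/
theorem Linked.natCast_ne {s t : ℂ} (h : Linked s t) (k : ℕ) : (k : ℂ) ≠ 1 / 2 + s - t := by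
  intro hk
  have h2 : ∃ z : ℤ, s - t = z := by
    rcases h with rfl | ⟨rfl, rfl⟩ | ⟨rfl, rfl⟩
    exacts [⟨0, by simp⟩, ⟨-1, by simp⟩, ⟨1, by simp⟩]
  obtain ⟨z, hz⟩ := h2
  have h3 : ((2 * k : ℤ) : ℂ) = ((1 + 2 * z : ℤ) : ℂ) := by
    push_cast
    linear_combination 2 * hk + 2 * hz
  have h4 : (2 * k : ℤ) = 1 + 2 * z := by exact_mod_cast h3
  omega

/-- A primary field of weight `3 / 2` acts by zero. -/
theorem IsPrimary.eq_zero_of_half {f g : ℤ → ℤ → ℂ[X][X]} (h : IsPrimary (1 / 2) f g) {a : ℤ → ℂ}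
    (h0 : ∀ m x y, (f 0 m).evalEval x y = x + a m * y) (ha : ∀ m n, Linked (a m) (a n))
    (j m : ℤ) : g j m = 0 :=
  eq_zero_of_euler (h.euler h0 j m) (ha _ _).natCast_ne

/-- A primary field of weight `1` acts by a scalar, up to rescaling of the generators. -/
theorem IsPrimary.exists_scalar {f g : ℤ → ℤ → ℂ[X][X]} (h : IsPrimary 0 f g) {a c : ℤ → ℂ}
    (h0 : ∀ m x y, (f 0 m).evalEval x y = x + a m * y) (ha : ∀ m n, Linked (a m) (a n))
    (hc : ∀ m, c m ≠ 0)
    (hf : ∀ i m x y, c m * (f i m).evalEval x y = c (i + m) * stdCoeff (a m) (a (i + m)) x y) :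
    ∃ d, ∀ j m x y, c m * (g j m).evalEval x y = c (j + m) * d := by
  have hconst : ∀ m, ∃ d, ∀ x y, (g 0 m).evalEval x y = d := by
    intro m
    obtain ⟨e, he⟩ := eval_eq_sum_of_euler (P := g 0 m) (n := 0) fun x y => by
      rw [h.euler h0, zero_add]
      simp
    exact ⟨e 0, fun x y => by simp [he]⟩
  choose d hd using hconst
  set G : ℤ → ℤ → ℂ → ℂ → ℂ := fun j m x y => c m / c (j + m) * (g j m).evalEval x y with hG
  have hfG : ∀ i m x y,
      (f i m).evalEval x y = c (i + m) / c m * stdCoeff (a m) (a (i + m)) x y := fun i m x y => by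
    have := hf i m x y
    have := hc m
    field_simp
    linear_combination hf i m x y
  have hgG : ∀ i m x y, (g i m).evalEval x y = c (i + m) / c m * G i m x y := fun i m x y => by
    have := hc m
    have := hc (i + m)
    simp only [hG]
    field_simp
  have hrel : ∀ (i j m : ℤ) (x l u : ℂ),
      G j m (x + l) u * stdCoeff (a (j + m)) (a (i + (j + m))) x l -
        stdCoeff (a m) (a (i + m)) (x + u) l * G j (i + m) x u = -u * G (i + j) m x (l + u) := by
    intro i j m x l u
    have := h i j m x l u
    simp only [hfG, hgG] at this
    rw [add_left_comm j i m, add_assoc i j m] at this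
    have h1 := hc m
    have h2 := hc (i + m)
    have h3 := hc (j + m)
    have h4 := hc (i + (j + m))
    field_simp at this
    linear_combination this
  have hG0 : ∀ m x y, G 0 m x y = d m := fun m x y => by
    simp [hG, hd, hc]
  clear_value G
  have hdc : ∀ m, d m = d 0 := fun m => by
    have h1 := hrel m 0 0 1 0 0
    simp only [hG0, add_zero, stdCoeff_one_zero] at h1
    linear_combination -h1
  -- The relation with `j = 0`: as `g_0` acts by the scalar `d 0`, every `G i m` is `d 0` times a
  -- difference quotient in `∂` of the standard coefficient. Between equal weights this quotient is
  -- `1`.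
  have key : ∀ i m x l u, d 0 * (stdCoeff (a m) (a (i + m)) x l -
      stdCoeff (a m) (a (i + m)) (x + u) l) = -u * G i m x (l + u) := fun i m x l u => by
    have h1 := hrel i 0 m x l u
    simp only [hG0, hdc m, hdc (i + m), zero_add, add_zero] at h1
    linear_combination h1
  suffices hs : ∃ D, ∀ j m x y, G j m x y = D by
    obtain ⟨D, hD⟩ := hs
    refine ⟨D, fun j m x y => ?_⟩
    have := hc m
    rw [hgG, hD]
    field_simp
  have hval : ∀ j m x y, G j m x y =
      d 0 * (stdCoeff (a m) (a (j + m)) (x + 1) (y - 1) - stdCoeff (a m) (a (j + m)) x (y - 1)) :=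
    fun j m x y => by
      have := key j m x (y - 1) 1
      rw [sub_add_cancel] at this
      linear_combination this
  obtain ⟨α, hα⟩ | h01 := eq_const_or_of_linked ha
  · refine ⟨d 0, fun j m x y => ?_⟩
    rw [hval, hα, hα]
    simp only [stdCoeff, if_true]
    ring
  by_cases hne : ∃ p q, a p = 0 ∧ a q = 1
  · obtain ⟨p, q, hp, hq⟩ := hne
    -- If both weights occur, then `d 0 = 0`. The passage from `p` (weight `0`) to `q` (weight `1`)
    -- has constant standard coefficient, so `G (q - p) p = 0`. The other product on the left is `2
    -- d 0` or `3 d 0`, according to the weight in degree `-(q - p) + p`, and it must equal `d 0`.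
    have h1 := hrel (-(q - p)) (q - p) p 1 0 1
    have e1 : -(q - p) + q = p := by ring
    have e3 : q - p + (-(q - p) + p) = p := by ring
    simp only [neg_add_cancel, e1, e3, hG0, hdc p, hval, sub_add_cancel, hp, hq] at h1
    have hd0 : d 0 = 0 := by
      rcases h01 (-(q - p) + p) with h2 | h2 <;> rw [h2] at h1 <;>
      · norm_num [stdCoeff] at h1
        first | linear_combination h1 | linear_combination h1 / 2
    exact ⟨0, fun j m x y => by rw [hval, hd0, zero_mul]⟩
  · push Not at hne
    refine ⟨d 0, fun j m x y => ?_⟩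
    have hjm : a (j + m) = a m := by
      rcases h01 m with h1 | h1 <;> rcases h01 (j + m) with h2 | h2
      · rw [h1, h2]
      · exact absurd h2 (hne _ _ h1)
      · exact absurd h1 (hne _ _ h2)
      · rw [h1, h2]
    rw [hval, hjm]
    simp only [stdCoeff, if_true]
    ring

/-- For pairwise linked weights, `stdCoeff` is the coefficient of one of the intermediate series. -/
theorem exists_model {a : ℤ → ℂ} (ha : ∀ m n, Linked (a m) (a n)) (b : ℂ) :
    (∃ α, ∀ i m x y, (densityCoeff α b i m).evalEval x y =
      stdCoeff (a m) (a (i + m)) (x + b) y) ∨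
    (∃ A : ℤ → Fin 2, ∀ i m x y, (twoStateCoeff A b i m).evalEval x y =
      stdCoeff (a m) (a (i + m)) (x + b) y) := by
  obtain ⟨α, hα⟩ | h := eq_const_or_of_linked ha
  · refine .inl ⟨α, fun i m x y => ?_⟩
    simp only [hα, stdCoeff, densityCoeff, if_true]
    simp [evalEval_C]
    ring
  · classical
    refine .inr ⟨fun m => if a m = 0 then 0 else 1, fun i m x y => ?_⟩
    rcases h m with h1 | h1 <;> rcases h (i + m) with h2 | h2 <;>
    · simp [twoStateCoeff, stdCoeff, h1, h2, evalEval_C]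

theorem IsPrimary.zero_ne_zero {κ : ℂ} {f g : ℤ → ℤ → ℂ[X][X]} (hf : IsPrimary 1 f f)
    (h : IsPrimary κ f g) {j m : ℤ} (hg : g j m ≠ 0) : f 0 m ≠ 0 := fun hm => by
  obtain ⟨a, -, b, h0, -⟩ := hf.exists_of_ne_zero h hg
  have := h0 (1 - b) 0
  simp [hm] at this

/-- The shift of `∂` by `-b` reduces everything to `b = 0` and is undone at the end. The same
scalars `c` serve for `L` and for the fields of weight `1`, so one rescaling of generators
normalizes both. -/
theorem IsPrimary.exists_standard {f : ℤ → ℤ → ℂ[X][X]} (hf : IsPrimary 1 f f)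
    {m : ℤ} (hm : f 0 m ≠ 0) :
    ∃ (a : ℤ → ℂ) (b : ℂ) (c : ℤ → ℂ), (∀ m n, Linked (a m) (a n)) ∧ (∀ m, c m ≠ 0) ∧
      (∀ i m x y, c m * (f i m).evalEval x y =
        c (i + m) * stdCoeff (a m) (a (i + m)) (x + b) y) ∧
      (∀ g, IsPrimary (1 / 2) f g → g = 0) ∧
      ∀ g, IsPrimary 0 f g → ∃ d, ∀ j m x y, c m * (g j m).evalEval x y = c (j + m) * d := by
  obtain ⟨b, a, hab⟩ := hf.exists_zero_eq hm
  have hab' : ∀ m x y, (_root_.shear 0 (-b) (f 0 m)).evalEval x y = x + a m * y := fun m x y => by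
    rw [evalEval_shear, hab]
    ring
  have hback : ∀ (P : ℂ[X][X]) x y, P.evalEval x y = (_root_.shear 0 (-b) P).evalEval (x + b) y :=
    fun P x y => by rw [evalEval_shear]; ring_nf
  obtain ⟨ha, c, hc, hfc⟩ := (hf.shear (-b)).exists_rescaling hab'
  refine ⟨a, b, c, ha, hc, fun i m x y => ?_, fun g hg => ?_, fun g hg => ?_⟩
  · rw [hback, hfc]
  · funext j m
    exact shear_eq_zero_iff.1 ((hg.shear (-b)).eq_zero_of_half hab' ha j m)
  · obtain ⟨d, hd⟩ := (hg.shear (-b)).exists_scalar hab' ha hc hfc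
    exact ⟨d, fun j m x y => by rw [hback, hd]⟩

/-! ### Translation between modules and their coefficient polynomials. -/

section Coordinates

theorem PolynomialModule.exists_dual_polynomial {V : Type*} [AddCommGroup V] [Module ℂ V]
    (ψ : V →ₗ[ℂ] ℂ) (p : PolynomialModule ℂ V) :
    ∃ P : ℂ[X], (∀ n, P.coeff n = ψ (p.coeff n)) ∧
      ∀ t, P.eval t = ψ (PolynomialModule.eval t p) := by
  refine ⟨p.coeff.sum fun n v => monomial n (ψ v), fun n => ?_, fun t => ?_⟩
  · simp only [Finsupp.sum, finsetSum_coeff, coeff_monomial]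
    simp only [Finset.sum_ite_eq', Finsupp.mem_support_iff]
    split_ifs with h0
    · rfl
    · rw [Finsupp.notMem_support_iff.1 (by simpa using h0), map_zero]
  · rw [PolynomialModule.eval_apply]
    simp [Finsupp.sum, eval_finsetSum, mul_comm]

/-- Isomorphism is defined on coefficients of powers of `λ`, while computations use values at
complex `λ`. A linear functional turns the comparison into one of ordinary polynomials over an
infinite field. -/
theorem PolynomialModule.dual_coeff_eq {V W : Type*} [AddCommGroup V] [Module ℂ V]
    [AddCommGroup W] [Module ℂ W] (ψ : V →ₗ[ℂ] ℂ) (χ : W →ₗ[ℂ] ℂ) {p : PolynomialModule ℂ V}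
    {q : PolynomialModule ℂ W}
    (h : ∀ t, ψ (PolynomialModule.eval t p) = χ (PolynomialModule.eval t q)) (n : ℕ) :
    ψ (p.coeff n) = χ (q.coeff n) := by
  obtain ⟨P, hP, hP'⟩ := PolynomialModule.exists_dual_polynomial ψ p
  obtain ⟨Q, hQ, hQ'⟩ := PolynomialModule.exists_dual_polynomial χ q
  rw [← hP, ← hQ, Polynomial.funext fun t => (hP' t).trans ((h t).trans (hQ' t).symm)]

theorem exists_basis {V : Type*} [AddCommGroup V] [Module ℂ[X] V]
    {U : ℤ → Submodule ℂ[X] V} (hU : DirectSum.IsInternal U)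
    (h : ∀ i, ∃ v : V, U i = Submodule.span ℂ[X] {v} ∧ ∀ p : ℂ[X], p • v = 0 → p = 0) :
    ∃ B : Module.Basis ℤ ℂ[X] V, ∀ i, U i = Submodule.span ℂ[X] {B i} := by
  choose v hv hp using h
  have hUv : U = fun i => Submodule.span ℂ[X] {v i} := funext hv
  have hli : LinearIndependent ℂ[X] v := by
    refine Ideal.iSupIndep.linearIndependent' (hUv ▸ hU.submodule_iSupIndep) fun i => ?_
    rw [eq_bot_iff]
    intro p hpv
    exact hp i p (by simpa [Ideal.mem_torsionOf_iff] using hpv)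
  have hsp : ⊤ ≤ Submodule.span ℂ[X] (Set.range v) := by
    rw [← hU.submodule_iSup_eq_top, hUv, Submodule.span_range_eq_iSup]
  exact ⟨.mk hli hsp, fun i => by rw [Module.Basis.mk_apply, hv]⟩

variable {V : Type*} [AddCommGroup V] [Module ℂ V] [Module ℂ[X] V]
variable {γ : Type*} [LieConformalAlgebra (γ × ℤ →₀ ℂ[X])]
  {ρ : LambdaMap (γ × ℤ →₀ ℂ[X]) V}

theorem IsConformalModule.ev_smul_left (hρ : IsConformalModule ρ) (p : ℂ[X]) (a : γ × ℤ →₀ ℂ[X])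
    (v : V) (t : ℂ) : ρ.ev t (p • a) v = p.eval (-t) • ρ.ev t a v := by
  induction p using Polynomial.induction_on with
  | C z => rw [← Polynomial.algebraMap_eq, algebraMap_smul]; simp
  | add p q hp hq => simp only [add_smul, map_add, LinearMap.add_apply, hp, hq, eval_add]
  | monomial n z h =>
    rw [pow_succ', mul_left_comm, mul_smul, hρ.del_left, h, eval_mul (p := X), eval_X, mul_smul, neg_smul]

variable [IsScalarTower ℂ ℂ[X] V]

theorem exists_eval_eq_smul {q : PolynomialModule ℂ V} {w : V}
    (h : ∀ n, q.coeff n ∈ Submodule.span ℂ[X] {w}) :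
    ∃ P : ℂ[X][X], ∀ t, PolynomialModule.eval t q = P.eval (C t) • w := by
  choose a ha using fun n => Submodule.mem_span_singleton.1 (h n)
  refine ⟨∑ n ∈ q.coeff.support, monomial n (a n), fun t => ?_⟩
  rw [eval_eq_lamSubst, lamSubst, Finsupp.sum, eval_finsetSum, Finset.sum_smul]
  refine Finset.sum_congr rfl fun n _ => ?_
  rw [eval_monomial, mul_comm, mul_smul, ha]

theorem IsConformalModule.ev_smul_right (hρ : IsConformalModule ρ) (q : ℂ[X]) (a : γ × ℤ →₀ ℂ[X])
    (v : V) (t : ℂ) : ρ.ev t a (q • v) = q.comp (X + C t) • ρ.ev t a v := by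
  induction q using Polynomial.induction_on with
  | C z => rw [C_comp, ← Polynomial.algebraMap_eq, algebraMap_smul, algebraMap_smul, map_smul]
  | add p q hp hq => simp only [add_smul, map_add, hp, hq, add_comp]
  | monomial n z h =>
    rw [pow_succ', mul_left_comm, mul_smul, hρ.del_right, h, mul_comp X, X_comp, mul_smul, add_smul,
      ← Polynomial.algebraMap_eq, algebraMap_smul]

/-- In the basis `B`, the generator `x` acts by `x λ B_m = P_{x,m}(∂, λ) B_{i+m}`, where `i` is
the degree of `x`. -/
def HasCoeffs (ρ : LambdaMap (γ × ℤ →₀ ℂ[X]) V) (B : Module.Basis ℤ ℂ[X] V)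
    (P : γ × ℤ → ℤ → ℂ[X][X]) : Prop :=
  ∀ x m t, ρ.ev t (Finsupp.single x 1) (B m) = (P x m).eval (C t) • B (x.2 + m)

theorem IsFreeIntermediateSeries.exists_hasCoeffs
    (hρ : IsFreeIntermediateSeries (degreePiece γ) ρ) :
    IsConformalModule ρ ∧ ∃ B P, HasCoeffs ρ B P := by
  obtain ⟨hρ, U, hU, hgr, hfree⟩ := hρ
  obtain ⟨B, hB⟩ := exists_basis hU hfree
  have : ∀ x m, ∃ P : ℂ[X][X], ∀ t,
      ρ.ev t (Finsupp.single x 1) (B m) = P.eval (C t) • B (x.2 + m) := fun x m => by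
    refine exists_eval_eq_smul fun n => ?_
    rw [← hB]
    refine hgr _ _ _ (Finsupp.single_mem_supported _ _ rfl) _ ?_ n
    rw [hB]
    exact Submodule.mem_span_singleton_self _
  choose P hP using this
  exact ⟨hρ, B, P, hP⟩

/-- Moving `P(∂, λ)` past an operator with parameter `l` replaces `∂` by `∂ + l`, and in the bracket
`Q(∂)` acts as `Q(-(l + u))`. The `B`-coordinate in degree `i + j + m` is then compared at `∂ = s`.
-/
theorem HasCoeffs.commutator {B : Module.Basis ℤ ℂ[X] V} {P : γ × ℤ → ℤ → ℂ[X][X]}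
    (h : HasCoeffs ρ B P) (hρ : IsConformalModule ρ) {x y z : γ} {i j : ℤ} {l : ℂ} {Q : ℂ[X]}
    (hQ : (LieConformalAlgebra.bracket (R := γ × ℤ →₀ ℂ[X])).ev l (Finsupp.single (x, i) 1)
      (Finsupp.single (y, j) 1) = Finsupp.single (z, i + j) Q) (m : ℤ) (s u : ℂ) :
    (P (y, j) m).evalEval (s + l) u * (P (x, i) (j + m)).evalEval s l -
      (P (x, i) m).evalEval (s + u) l * (P (y, j) (i + m)).evalEval s u =
    Q.eval (-(l + u)) * (P (z, i + j) m).evalEval s (l + u) := by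
  have h1 := hρ.commutator (Finsupp.single (x, i) 1) (Finsupp.single (y, j) 1) (B m) l u
  rw [hQ, ← Finsupp.smul_single_one (z, i + j) Q, hρ.ev_smul_left] at h1
  simp only [h _ _ _, hρ.ev_smul_right] at h1
  rw [add_left_comm j i m, ← add_assoc i j m, ← algebraMap_smul ℂ[X] (Q.eval _),
    Polynomial.algebraMap_eq] at h1
  simp only [smul_smul, ← sub_smul] at h1
  have h2 := congrArg (fun v => (B.repr v (i + j + m)).eval s) h1
  simpa [evalEval, eval_comp] using h2

/-- The isomorphism is the coordinate map of the rescaled basis `c m • B m`; on generators `hF` says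
exactly that it intertwines the actions, and sesquilinearity does the rest. -/
theorem HasCoeffs.areIsomorphic {B : Module.Basis ℤ ℂ[X] V} {P : γ × ℤ → ℤ → ℂ[X][X]}
    (h : HasCoeffs ρ B P) (hρ : IsConformalModule ρ) {c : ℤ → ℂ} (hc : ∀ m, c m ≠ 0)
    {F : γ × ℤ → ℤ → ℂ[X][X]} {K : γ × ℤ → ℤ → ℤ →₀ ℂ[X][X]}
    (hK : ∀ x m, K x m = Finsupp.single (x.2 + m) (F x m))
    (hF : ∀ x m s t, c m * (P x m).evalEval s t = c (x.2 + m) * (F x m).evalEval s t) :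
    AreIsomorphic ρ (sesq K) := by
  set B' := B.isUnitSMul (w := fun m => C (c m)) fun m => isUnit_C.2 (hc m).isUnit with hB'
  have hBm : ∀ m, B' m = C (c m) • B m := fun m => by rw [hB', Module.Basis.isUnitSMul_apply]
  have hgen : ∀ x m t, ρ.ev t (Finsupp.single x 1) (B' m) = (F x m).eval (C t) • B' (x.2 + m) := by
    intro x m t
    rw [hBm, hBm, hρ.ev_smul_right, h, smul_smul, smul_smul, C_comp]
    congr 1
    refine Polynomial.funext fun s => ?_
    have := hF x m s t
    simp only [evalEval] at this
    simp [this, mul_comm]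
  have hev : ∀ t a w, B'.repr (ρ.ev t a (B'.repr.symm w)) = (sesq K).ev t a w := by
    intro t a w
    induction a using Finsupp.induction_linear with
    | zero => simp
    | add a b ha hb => simp only [map_add, LinearMap.add_apply, ha, hb]
    | single x p =>
    induction w using Finsupp.induction_linear with
    | zero => simp
    | add v w hv hw => simp only [map_add, hv, hw]
    | single k q =>
    rw [sesq_ev_single, hK, Finsupp.mapRange_single, ← Finsupp.smul_single_one x p,
      hρ.ev_smul_left, ← Finsupp.smul_single_one k q, map_smul B'.repr.symm, hρ.ev_smul_right,
      Module.Basis.repr_symm_single_one, hgen, ← algebraMap_smul ℂ[X] (p.eval (-t)),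
      Polynomial.algebraMap_eq, smul_smul, smul_smul, map_smul B'.repr, Module.Basis.repr_self,
      Finsupp.smul_single, Finsupp.smul_single, smul_eq_mul, smul_eq_mul, mul_one, mul_assoc]
  refine ⟨B'.repr, fun a v n => ?_⟩
  ext k d
  -- The coefficient of `∂ᵈ v_k`; these functionals separate the elements of the free module.
  let χ : (ℤ →₀ ℂ[X]) →ₗ[ℂ] ℂ := (lcoeff ℂ d).comp (Finsupp.lapply k)
  refine PolynomialModule.dual_coeff_eq (χ.comp (B'.repr.toLinearMap.restrictScalars ℂ)) χ
    (fun t => ?_) n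
  have := hev t a (B'.repr v)
  rw [LinearEquiv.symm_apply_apply] at this
  exact congrArg χ this

theorem HasCoeffs.exists_ne_zero {B : Module.Basis ℤ ℂ[X] V} {P : γ × ℤ → ℤ → ℂ[X][X]}
    (h : HasCoeffs ρ B P) (hρ : IsConformalModule ρ) (hne : IsNontrivialAction ρ) :
    ∃ x m, P x m ≠ 0 := by
  by_contra! h0
  -- With all coefficients zero, the action is isomorphic to the zero action.
  obtain ⟨φ, hφ⟩ := h.areIsomorphic hρ (c := fun _ => 1) (F := fun _ _ => 0)
    (K := fun _ _ => 0) (by simp) (by simp) (by simp [h0])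
  obtain ⟨a, v, hav⟩ := hne
  refine hav (PolynomialModule.coeff_injective (Finsupp.ext fun n => φ.injective ?_))
  rw [hφ]
  have := sesq_mem_supported (fun (_ : γ × ℤ) (_ : ℤ) => (0 : ℤ →₀ ℂ[X][X])) Set.univ Set.univ ∅
    (by simp) a (by simp) (φ v) (by simp) n
  simpa using this

end Coordinates

/-! ### Application to the two algebras. -/

theorem HasCoeffs.isPrimary {V : Type*} [AddCommGroup V] [Module ℂ V] [Module ℂ[X] V]
    [IsScalarTower ℂ ℂ[X] V] {γ : Type*} [LieConformalAlgebra (γ × ℤ →₀ ℂ[X])]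
    {ρ : LambdaMap (γ × ℤ →₀ ℂ[X]) V} {B : Module.Basis ℤ ℂ[X] V} {P : γ × ℤ → ℤ → ℂ[X][X]}
    (h : HasCoeffs ρ B P) (hρ : IsConformalModule ρ) {x y : γ} {κ : ℂ}
    (hQ : ∀ i j l, (LieConformalAlgebra.bracket (R := γ × ℤ →₀ ℂ[X])).ev l
      (Finsupp.single (x, i) 1) (Finsupp.single (y, j) 1) =
        Finsupp.single (y, i + j) (X + C ((κ + 1) * l))) :
    IsPrimary κ (fun i => P (x, i)) (fun j => P (y, j)) := by
  intro i j m s l u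
  rw [h.commutator hρ (hQ i j l)]
  simp only [eval_add, eval_X, eval_C]
  ring

/-- Needed for `M`, whose weight `1` does not exclude a nonzero action by homogeneity; instead `M`
lies in the brackets of `Y` with itself. -/
theorem HasCoeffs.eq_zero_of_commutator {V : Type*} [AddCommGroup V] [Module ℂ V] [Module ℂ[X] V]
    [IsScalarTower ℂ ℂ[X] V] {γ : Type*} [LieConformalAlgebra (γ × ℤ →₀ ℂ[X])]
    {ρ : LambdaMap (γ × ℤ →₀ ℂ[X]) V} {B : Module.Basis ℤ ℂ[X] V} {P : γ × ℤ → ℤ → ℂ[X][X]}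
    (h : HasCoeffs ρ B P) (hρ : IsConformalModule ρ) {y z : γ}
    (hQ : ∀ i j l, (LieConformalAlgebra.bracket (R := γ × ℤ →₀ ℂ[X])).ev l
      (Finsupp.single (y, i) 1) (Finsupp.single (y, j) 1) =
        Finsupp.single (z, i + j) (X + C (2 * l)))
    (hy : ∀ i m, P (y, i) m = 0) (i m : ℤ) : P (z, i) m = 0 := by
  rw [← evalEval_eq_zero_iff]
  intro s t
  -- The factor `∂ + 2λ` acts as `l - u`; these parameters give `l - u = 1` and `l + u = t`.
  have := h.commutator hρ (hQ 0 i ((t + 1) / 2)) m s ((t - 1) / 2)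
  simp only [hy, evalEval_zero, zero_mul, sub_zero, zero_add, eval_add, eval_X, eval_C] at this
  rw [show (t + 1) / 2 + (t - 1) / 2 = t by ring] at this
  linear_combination -this

theorem csv_bracket_ev (x y : SVGen × ℤ) (l : ℂ) :
    (LieConformalAlgebra.bracket (R := Csv)).ev l (Finsupp.single x 1) (Finsupp.single y 1) =
      Finsupp.mapRange (Polynomial.eval (C l)) eval_zero (csvBracket x y) := by
  refine (sesq_ev_single csvBracket x y 1 1 l).trans ?_
  simp

/-- The number `κ` with `[L_i λ g_j] = (∂ + (κ + 1)λ) g_{i+j}`. -/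
noncomputable def SVGen.weight : SVGen → ℂ
  | .L => 1
  | .M => 0
  | .Y => 1 / 2

theorem csv_bracket_L_ev (g : SVGen) (i j : ℤ) (l : ℂ) :
    (LieConformalAlgebra.bracket (R := Csv)).ev l (Finsupp.single (.L, i) 1)
      (Finsupp.single (g, j) 1) = Finsupp.single (g, i + j) (X + C ((g.weight + 1) * l)) := by
  rw [csv_bracket_ev]
  cases g <;> simp only [csvBracket, Finsupp.mapRange_single, SVGen.weight] <;>
  · refine congrArg (Finsupp.single _) (Polynomial.funext fun x => ?_)
    simp [-mul_eq_mul_right_iff]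
    try ring

theorem csv_bracket_Y_ev (i j : ℤ) (l : ℂ) :
    (LieConformalAlgebra.bracket (R := Csv)).ev l (Finsupp.single (.Y, i) 1)
      (Finsupp.single (.Y, j) 1) = Finsupp.single (.M, i + j) (X + C (2 * l)) := by
  rw [csv_bracket_ev]
  simp only [csvBracket, Finsupp.mapRange_single]
  refine congrArg (Finsupp.single _) (Polynomial.funext fun x => ?_)
  simp

theorem extCsv_bracket_ev (x y : ExtSVGen × ℤ) (l : ℂ) :
    (LieConformalAlgebra.bracket (R := ExtCsv)).ev l (Finsupp.single x 1) (Finsupp.single y 1) =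
      Finsupp.mapRange (Polynomial.eval (C l)) eval_zero (extCsvBracket x y) := by
  refine (sesq_ev_single extCsvBracket x y 1 1 l).trans ?_
  simp

/-- The number `κ` with `[L_i λ g_j] = (∂ + (κ + 1)λ) g_{i+j}`. -/
noncomputable def ExtSVGen.weight : ExtSVGen → ℂ
  | .L => 1
  | .M => 0
  | .Y => 1 / 2
  | .N => 0

theorem extCsv_bracket_L_ev (g : ExtSVGen) (i j : ℤ) (l : ℂ) :
    (LieConformalAlgebra.bracket (R := ExtCsv)).ev l (Finsupp.single (.L, i) 1)
      (Finsupp.single (g, j) 1) = Finsupp.single (g, i + j) (X + C ((g.weight + 1) * l)) := by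
  rw [extCsv_bracket_ev]
  cases g <;> simp only [extCsvBracket, Finsupp.mapRange_single, ExtSVGen.weight] <;>
  · refine congrArg (Finsupp.single _) (Polynomial.funext fun x => ?_)
    simp [-mul_eq_mul_right_iff]
    try ring

theorem extCsv_bracket_Y_ev (i j : ℤ) (l : ℂ) :
    (LieConformalAlgebra.bracket (R := ExtCsv)).ev l (Finsupp.single (.Y, i) 1)
      (Finsupp.single (.Y, j) 1) = Finsupp.single (.M, i + j) (X + C (2 * l)) := by
  rw [extCsv_bracket_ev]
  simp only [extCsvBracket, Finsupp.mapRange_single]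
  refine congrArg (Finsupp.single _) (Polynomial.funext fun x => ?_)
  simp

theorem csv_classification {V : Type*} [AddCommGroup V] [Module ℂ V] [Module ℂ[X] V]
    [IsScalarTower ℂ ℂ[X] V] {ρ : LambdaMap Csv V}
    (hρ : IsFreeIntermediateSeries (degreePiece SVGen) ρ) (hne : IsNontrivialAction ρ) :
    (∃ a b : ℂ, AreIsomorphic ρ (csvAction (densityCoeff a b))) ∨
    (∃ (A : ℤ → Fin 2) (b : ℂ), AreIsomorphic ρ (csvAction (twoStateCoeff A b))) := by
  obtain ⟨hρ, B, P, hP⟩ := hρ.exists_hasCoeffs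
  have hprim : ∀ g : SVGen, IsPrimary g.weight (fun i => P (.L, i)) (fun i => P (g, i)) :=
    fun g => hP.isPrimary hρ (csv_bracket_L_ev g)
  obtain ⟨⟨x, i⟩, m, hx⟩ := hP.exists_ne_zero hρ hne
  obtain ⟨a, b, c, ha, hc, hf, hhalf, -⟩ :=
    (hprim .L).exists_standard ((hprim .L).zero_ne_zero (hprim x) hx)
  have hY : ∀ i m, P (.Y, i) m = 0 := fun i m => congrFun (congrFun (hhalf _ (hprim .Y)) i) m
  have hM := hP.eq_zero_of_commutator hρ csv_bracket_Y_ev hY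
  have key : ∀ f : ℤ → ℤ → ℂ[X][X], (∀ i m x y, (f i m).evalEval x y =
      stdCoeff (a m) (a (i + m)) (x + b) y) → AreIsomorphic ρ (csvAction f) := fun f hff =>
    hP.areIsomorphic hρ hc (F := fun x m => match x with
      | (.L, i) => f i m
      | (.M, _) => 0
      | (.Y, _) => 0)
      (by rintro ⟨_ | _, i⟩ m <;> simp)
      (by rintro ⟨_ | _, i⟩ m s t <;> simp [hf, hff, hM, hY])
  obtain ⟨α, h⟩ | ⟨A, h⟩ := exists_model ha b
  · exact .inl ⟨α, b, key _ h⟩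
  · exact .inr ⟨A, b, key _ h⟩

theorem extCsv_classification {V : Type*} [AddCommGroup V] [Module ℂ V] [Module ℂ[X] V]
    [IsScalarTower ℂ ℂ[X] V] {ρ : LambdaMap ExtCsv V}
    (hρ : IsFreeIntermediateSeries (degreePiece ExtSVGen) ρ) (hne : IsNontrivialAction ρ) :
    (∃ a b d : ℂ, AreIsomorphic ρ (extCsvAction (densityCoeff a b) d)) ∨
    (∃ (A : ℤ → Fin 2) (b d : ℂ),
      AreIsomorphic ρ (extCsvAction (twoStateCoeff A b) d)) := by
  obtain ⟨hρ, B, P, hP⟩ := hρ.exists_hasCoeffs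
  have hprim : ∀ g : ExtSVGen, IsPrimary g.weight (fun i => P (.L, i)) (fun i => P (g, i)) :=
    fun g => hP.isPrimary hρ (extCsv_bracket_L_ev g)
  obtain ⟨⟨x, i⟩, m, hx⟩ := hP.exists_ne_zero hρ hne
  obtain ⟨a, b, c, ha, hc, hf, hhalf, hone⟩ :=
    (hprim .L).exists_standard ((hprim .L).zero_ne_zero (hprim x) hx)
  have hY : ∀ i m, P (.Y, i) m = 0 := fun i m => congrFun (congrFun (hhalf _ (hprim .Y)) i) m
  have hM := hP.eq_zero_of_commutator hρ extCsv_bracket_Y_ev hY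
  obtain ⟨d, hN⟩ := hone _ (hprim .N)
  have key : ∀ f : ℤ → ℤ → ℂ[X][X], (∀ i m x y, (f i m).evalEval x y =
      stdCoeff (a m) (a (i + m)) (x + b) y) → AreIsomorphic ρ (extCsvAction f d) := fun f hff =>
    hP.areIsomorphic hρ hc (F := fun x m => match x with
      | (.L, i) => f i m
      | (.M, _) => 0
      | (.Y, _) => 0
      | (.N, _) => cst d)
      (by rintro ⟨_ | _, i⟩ m <;> simp)
      (by rintro ⟨_ | _, i⟩ m s t <;> simp [hf, hff, hM, hY, hN, evalEval_C])
  obtain ⟨α, h⟩ | ⟨A, h⟩ := exists_model ha b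
  · exact .inl ⟨α, b, d, key _ h⟩
  · exact .inr ⟨A, b, d, key _ h⟩

theorem mainTheorem4 (V : Type*) [AddCommGroup V] [Module ℂ V] [Module ℂ[X] V]
    [IsScalarTower ℂ ℂ[X] V] :
    (∀ ρ : LambdaMap Csv V,
      IsFreeIntermediateSeries (degreePiece SVGen) ρ → IsNontrivialAction ρ →
        (∃ a b : ℂ, AreIsomorphic ρ (csvAction (densityCoeff a b))) ∨
        (∃ (A : ℤ → Fin 2) (b : ℂ), AreIsomorphic ρ (csvAction (twoStateCoeff A b)))) ∧
    (∀ ρ : LambdaMap ExtCsv V,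
      IsFreeIntermediateSeries (degreePiece ExtSVGen) ρ → IsNontrivialAction ρ →
        (∃ a b d : ℂ, AreIsomorphic ρ (extCsvAction (densityCoeff a b) d)) ∨
        (∃ (A : ℤ → Fin 2) (b d : ℂ),
          AreIsomorphic ρ (extCsvAction (twoStateCoeff A b) d))) :=
  ⟨fun _ hρ hne => csv_classification hρ hne, fun _ hρ hne => extCsv_classification hρ hne⟩
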